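/- Let \(\mathrm{ITT}\) be intensional Martin-Löf type theory with \(\Pi\) types, \(\Sigma\) types, intensional identity types (with path induction), binary coproduct types, an empty type, a unit type, and one universe \(\mathcal U\) closed under all of these type formers, with strict (judgmental) \(\beta\) rules for all type formers and strict \(\eta\) rules for \(\Pi\) types, \(\Sigma\) types and the unit type. (No function extensionality is assumed.) For \(f,g : \prod_{a:A}B(a)\) write \(f\sim g\) for the type \(\prod_{a:A} f(a)=_{B(a)}g(a)\). A function \(f:A\to B\) is an *equivalence* if it is equipped with \(s,r:B\to A\) such that \(f\circ s\sim \mathrm{id}_B\) and \(r\circ f\sim\mathrm{id}_A\); it is a *categorical equivalence* if it is equipped with \(s,r:B\to A\) such that \(f\circ s=_{B\to B}\mathrm{id}_B\) and \(r\circ f=_{A\to A}\mathrm{id}_A\). Write \(A\simeq B\) and \(A\cong B\) for the types of equivalences and of categorical equivalences from \(A\) to \(B\). Consider the following types of \(\mathrm{ITT}\): - univalence \(\mathsf{UA}_{\mathcal U}\): for all \(A,B:\mathcal U\), the map \((A=_{\mathcal U}B)\to(A\simeq B)\), defined by path induction and sending \(\mathrm{refl}_A\) to the identity equivalence, is an equivalence;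 - categorical univalence \(\mathsf{CUA}_{\mathcal U}\): for all \(A,B:\mathcal U\), the map \((A=_{\mathcal U}B)\to(A\cong B)\), defined by path induction and sending \(\mathrm{refl}_A\) to the identity categorical equivalence, is an equivalence; - function extensionality \(\mathsf{FE}_{\mathcal U}\): for all \(A:\mathcal U\), \(B:A\to\mathcal U\) and \(f,g:\prod_{a:A}B(a)\), the map \((f=g)\to(f\sim g)\), defined by path induction and sending \(\mathrm{refl}_f\) to \(\lambda a.\,\mathrm{refl}_{f(a)}\), is an equivalence. Then \(\mathrm{ITT}\vdash \mathsf{UA}_{\mathcal U}\leftrightarrow(\mathsf{CUA}_{\mathcal U}\times\mathsf{FE}_{\mathcal U})\); that is, there is a closed term of \(\mathrm{ITT}\) of type \((\mathsf{UA}_{\mathcal U}\to\mathsf{CUA}_{\mathcal U}\times\mathsf{FE}_{\mathcal U})\times(\mathsf{CUA}_{\mathcal U}\times\mathsf{FE}_{\mathcal U}\to\mathsf{UA}_{\mathcal U})\). -/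

import Mathlib

namespace ITT

/-! ## Raw syntax

Intensional Martin-Löf type theory with one universe. Types and terms share one class of raw
expressions with de Bruijn indices (the universe is à la Russell: an element of `U` is itself a
type). The comment after each constructor says in which arguments variables are bound. -/

/-- Raw expressions. -/
inductive Tm : Type
  | var (n : ℕ)                -- the variable with de Bruijn index `n`
  | U                          -- the universe
  | Pi (A B : Tm)              -- `Π (x : A), B`, binds one variable in `B`
  | lam (A b : Tm)             -- `λ (x : A), b`, binds one variable in `b`
  | app (f a : Tm)
  | Sig (A B : Tm)             -- `Σ (x : A), B`, binds one variable in `B`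
  | pair (a b : Tm)
  | fst (p : Tm)
  | snd (p : Tm)
  | Id (A a b : Tm)            -- `a =_A b`
  | refl (a : Tm)
  | J (C d p : Tm)             -- path induction, motive `C` binds `y` (index 1) and `q` (index 0)
  | Sum (A B : Tm)             -- `A + B`
  | inl (a : Tm)
  | inr (b : Tm)
  | case (C l r s : Tm)        -- elimination of `s : A + B`, binds one variable in `C`, `l`, `r`
  | Empty
  | absurd (C e : Tm)          -- elimination of `e : Empty`, binds one variable in `C`
  | Unit
  | star

namespace Tm

/-- Extend a renaming under a binder. -/
def liftRen (ξ : ℕ → ℕ) : ℕ → ℕ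
  | 0 => 0
  | n + 1 => ξ n + 1

/-- Apply a renaming of the free variables. -/
def rename : (ℕ → ℕ) → Tm → Tm
  | ξ, var n => var (ξ n)
  | _, U => U
  | ξ, Pi A B => Pi (rename ξ A) (rename (liftRen ξ) B)
  | ξ, lam A b => lam (rename ξ A) (rename (liftRen ξ) b)
  | ξ, app f a => app (rename ξ f) (rename ξ a)
  | ξ, Sig A B => Sig (rename ξ A) (rename (liftRen ξ) B)
  | ξ, pair a b => pair (rename ξ a) (rename ξ b)
  | ξ, fst p => fst (rename ξ p)
  | ξ, snd p => snd (rename ξ p)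
  | ξ, Id A a b => Id (rename ξ A) (rename ξ a) (rename ξ b)
  | ξ, refl a => refl (rename ξ a)
  | ξ, J C d p => J (rename (liftRen (liftRen ξ)) C) (rename ξ d) (rename ξ p)
  | ξ, Sum A B => Sum (rename ξ A) (rename ξ B)
  | ξ, inl a => inl (rename ξ a)
  | ξ, inr b => inr (rename ξ b)
  | ξ, case C l r s =>
      case (rename (liftRen ξ) C) (rename (liftRen ξ) l) (rename (liftRen ξ) r) (rename ξ s)
  | _, Empty => Empty
  | ξ, absurd C e => absurd (rename (liftRen ξ) C) (rename ξ e)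
  | _, Unit => Unit
  | _, star => star

/-- Weakening by one variable. -/
def wk (t : Tm) : Tm := t.rename (· + 1)

/-- Extend a substitution under a binder. -/
def liftSub (σ : ℕ → Tm) : ℕ → Tm
  | 0 => var 0
  | n + 1 => (σ n).wk

/-- Simultaneous capture-avoiding substitution. -/
def subst : (ℕ → Tm) → Tm → Tm
  | σ, var n => σ n
  | _, U => U
  | σ, Pi A B => Pi (subst σ A) (subst (liftSub σ) B)
  | σ, lam A b => lam (subst σ A) (subst (liftSub σ) b)
  | σ, app f a => app (subst σ f) (subst σ a)
  | σ, Sig A B => Sig (subst σ A) (subst (liftSub σ) B)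
  | σ, pair a b => pair (subst σ a) (subst σ b)
  | σ, fst p => fst (subst σ p)
  | σ, snd p => snd (subst σ p)
  | σ, Id A a b => Id (subst σ A) (subst σ a) (subst σ b)
  | σ, refl a => refl (subst σ a)
  | σ, J C d p => J (subst (liftSub (liftSub σ)) C) (subst σ d) (subst σ p)
  | σ, Sum A B => Sum (subst σ A) (subst σ B)
  | σ, inl a => inl (subst σ a)
  | σ, inr b => inr (subst σ b)
  | σ, case C l r s =>
      case (subst (liftSub σ) C) (subst (liftSub σ) l) (subst (liftSub σ) r) (subst σ s)
  | _, Empty => Empty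
  | σ, absurd C e => absurd (subst (liftSub σ) C) (subst σ e)
  | _, Unit => Unit
  | _, star => star

/-- `t.inst a` is `t[a/x]`, where `x` is the last variable of the context of `t`. -/
def inst (t a : Tm) : Tm :=
  t.subst fun n => match n with
    | 0 => a
    | k + 1 => var k

/-- `t.inst₂ a b` is `t[a/x, b/y]`, where `x`, `y` are the last two variables of the context of
`t`, in this order (so `y` has index 0). -/
def inst₂ (t a b : Tm) : Tm :=
  t.subst fun n => match n with
    | 0 => b
    | 1 => a
    | k + 2 => var k

/-- `t.replace u` is `t[u/x]`, where `x` is the last variable of the context `Γ, x : A` of `t` and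
`u` lives over another extension `Γ, y : B` of the same context `Γ`. -/
def replace (t u : Tm) : Tm :=
  t.subst fun n => match n with
    | 0 => u
    | k + 1 => var (k + 1)

end Tm

open Tm

/-! ## Derivations -/

/-- Contexts; the head of the list is the type of the last variable. -/
abbrev Ctx : Type := List Tm

/-- `Lookup Γ n A`: the variable `n` of `Γ` has type `A` (weakened to `Γ`). -/
inductive Lookup : Ctx → ℕ → Tm → Prop
  | here (Γ : Ctx) (A : Tm) : Lookup (A :: Γ) 0 A.wk
  | there {Γ : Ctx} {n : ℕ} {A : Tm} (B : Tm) (h : Lookup Γ n A) : Lookup (B :: Γ) (n + 1) A.wk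

/-- The forms of judgment (in a context). -/
inductive Judgment : Type
  | ctx                        -- the context is well formed
  | ty (A : Tm)                -- `A` is a type
  | tm (a A : Tm)              -- `a : A`
  | eqTy (A B : Tm)            -- `A` and `B` are strictly equal types
  | eqTm (a b A : Tm)          -- `a` and `b` are strictly equal elements of `A`

open Judgment

/-- `Der Γ 𝒥`: the judgment `Γ ⊢ 𝒥` is derivable. -/
inductive Der : Ctx → Judgment → Prop
  -- Contexts and variables
  | nil : Der [] ctx
  | cons {Γ A} : Der Γ ctx → Der Γ (ty A) → Der (A :: Γ) ctx
  | var {Γ n A} : Der Γ ctx → Lookup Γ n A → Der Γ (tm (var n) A)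
  -- Strict equality is an equivalence relation, and typing respects it
  | ty_rfl {Γ A} : Der Γ (ty A) → Der Γ (eqTy A A)
  | ty_symm {Γ A B} : Der Γ (eqTy A B) → Der Γ (eqTy B A)
  | ty_trans {Γ A B C} : Der Γ (eqTy A B) → Der Γ (eqTy B C) → Der Γ (eqTy A C)
  | tm_rfl {Γ a A} : Der Γ (tm a A) → Der Γ (eqTm a a A)
  | tm_symm {Γ a b A} : Der Γ (eqTm a b A) → Der Γ (eqTm b a A)
  | tm_trans {Γ a b c A} : Der Γ (eqTm a b A) → Der Γ (eqTm b c A) → Der Γ (eqTm a c A)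
  | conv {Γ a A B} : Der Γ (tm a A) → Der Γ (eqTy A B) → Der Γ (tm a B)
  | conv_eq {Γ a b A B} : Der Γ (eqTm a b A) → Der Γ (eqTy A B) → Der Γ (eqTm a b B)
  -- The universe
  | U_ty {Γ} : Der Γ ctx → Der Γ (ty U)
  | el {Γ A} : Der Γ (tm A U) → Der Γ (ty A)
  | el_eq {Γ A B} : Der Γ (eqTm A B U) → Der Γ (eqTy A B)
  -- `Π` types
  | Pi_ty {Γ A B} : Der Γ (ty A) → Der (A :: Γ) (ty B) → Der Γ (ty (Pi A B))
  | Pi_eqTy {Γ A A' B B'} : Der Γ (ty A) → Der Γ (eqTy A A') → Der (A :: Γ) (eqTy B B') →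
      Der Γ (eqTy (Pi A B) (Pi A' B'))
  | Pi_U {Γ A B} : Der Γ (tm A U) → Der (A :: Γ) (tm B U) → Der Γ (tm (Pi A B) U)
  | Pi_eqU {Γ A A' B B'} : Der Γ (tm A U) → Der Γ (eqTm A A' U) → Der (A :: Γ) (eqTm B B' U) →
      Der Γ (eqTm (Pi A B) (Pi A' B') U)
  | lam {Γ A B b} : Der Γ (ty A) → Der (A :: Γ) (tm b B) → Der Γ (tm (lam A b) (Pi A B))
  | lam_eq {Γ A A' B b b'} : Der Γ (ty A) → Der Γ (eqTy A A') → Der (A :: Γ) (eqTm b b' B) →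
      Der Γ (eqTm (lam A b) (lam A' b') (Pi A B))
  | app {Γ A B f a} : Der Γ (tm f (Pi A B)) → Der Γ (tm a A) → Der Γ (tm (app f a) (B.inst a))
  | app_eq {Γ A B f f' a a'} : Der Γ (eqTm f f' (Pi A B)) → Der Γ (eqTm a a' A) →
      Der Γ (eqTm (app f a) (app f' a') (B.inst a))
  | Pi_beta {Γ A B b a} : Der Γ (ty A) → Der (A :: Γ) (tm b B) → Der Γ (tm a A) →
      Der Γ (eqTm (app (lam A b) a) (b.inst a) (B.inst a))
  | Pi_eta {Γ A B f} : Der Γ (tm f (Pi A B)) →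
      Der Γ (eqTm (lam A (app f.wk (var 0))) f (Pi A B))
  -- `Σ` types
  | Sig_ty {Γ A B} : Der Γ (ty A) → Der (A :: Γ) (ty B) → Der Γ (ty (Sig A B))
  | Sig_eqTy {Γ A A' B B'} : Der Γ (ty A) → Der Γ (eqTy A A') → Der (A :: Γ) (eqTy B B') →
      Der Γ (eqTy (Sig A B) (Sig A' B'))
  | Sig_U {Γ A B} : Der Γ (tm A U) → Der (A :: Γ) (tm B U) → Der Γ (tm (Sig A B) U)
  | Sig_eqU {Γ A A' B B'} : Der Γ (tm A U) → Der Γ (eqTm A A' U) → Der (A :: Γ) (eqTm B B' U) →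
      Der Γ (eqTm (Sig A B) (Sig A' B') U)
  | pair {Γ A B a b} : Der (A :: Γ) (ty B) → Der Γ (tm a A) → Der Γ (tm b (B.inst a)) →
      Der Γ (tm (pair a b) (Sig A B))
  | pair_eq {Γ A B a a' b b'} : Der (A :: Γ) (ty B) → Der Γ (eqTm a a' A) →
      Der Γ (eqTm b b' (B.inst a)) → Der Γ (eqTm (pair a b) (pair a' b') (Sig A B))
  | fst {Γ A B p} : Der Γ (tm p (Sig A B)) → Der Γ (tm (fst p) A)
  | fst_eq {Γ A B p p'} : Der Γ (eqTm p p' (Sig A B)) → Der Γ (eqTm (fst p) (fst p') A)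
  | snd {Γ A B p} : Der Γ (tm p (Sig A B)) → Der Γ (tm (snd p) (B.inst (fst p)))
  | snd_eq {Γ A B p p'} : Der Γ (eqTm p p' (Sig A B)) →
      Der Γ (eqTm (snd p) (snd p') (B.inst (fst p)))
  | fst_beta {Γ A B a b} : Der (A :: Γ) (ty B) → Der Γ (tm a A) → Der Γ (tm b (B.inst a)) →
      Der Γ (eqTm (fst (pair a b)) a A)
  | snd_beta {Γ A B a b} : Der (A :: Γ) (ty B) → Der Γ (tm a A) → Der Γ (tm b (B.inst a)) →
      Der Γ (eqTm (snd (pair a b)) b (B.inst a))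
  | Sig_eta {Γ A B p} : Der Γ (tm p (Sig A B)) →
      Der Γ (eqTm (pair (fst p) (snd p)) p (Sig A B))
  -- Identity types
  | Id_ty {Γ A a b} : Der Γ (ty A) → Der Γ (tm a A) → Der Γ (tm b A) → Der Γ (ty (Id A a b))
  | Id_eqTy {Γ A A' a a' b b'} : Der Γ (eqTy A A') → Der Γ (eqTm a a' A) →
      Der Γ (eqTm b b' A) → Der Γ (eqTy (Id A a b) (Id A' a' b'))
  | Id_U {Γ A a b} : Der Γ (tm A U) → Der Γ (tm a A) → Der Γ (tm b A) → Der Γ (tm (Id A a b) U)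
  | Id_eqU {Γ A A' a a' b b'} : Der Γ (eqTm A A' U) → Der Γ (eqTm a a' A) →
      Der Γ (eqTm b b' A) → Der Γ (eqTm (Id A a b) (Id A' a' b') U)
  | refl {Γ A a} : Der Γ (tm a A) → Der Γ (tm (refl a) (Id A a a))
  | refl_eq {Γ A a a'} : Der Γ (eqTm a a' A) → Der Γ (eqTm (refl a) (refl a') (Id A a a))
  | J {Γ A a b C d p} : Der Γ (tm a A) →
      Der (Id A.wk a.wk (var 0) :: A :: Γ) (ty C) → Der Γ (tm d (C.inst₂ a (refl a))) →
      Der Γ (tm b A) → Der Γ (tm p (Id A a b)) → Der Γ (tm (J C d p) (C.inst₂ b p))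
  | J_eq {Γ A a b C C' d d' p p'} : Der Γ (tm a A) →
      Der (Id A.wk a.wk (var 0) :: A :: Γ) (eqTy C C') →
      Der Γ (eqTm d d' (C.inst₂ a (refl a))) → Der Γ (tm b A) → Der Γ (eqTm p p' (Id A a b)) →
      Der Γ (eqTm (J C d p) (J C' d' p') (C.inst₂ b p))
  | J_beta {Γ A a C d} : Der Γ (tm a A) →
      Der (Id A.wk a.wk (var 0) :: A :: Γ) (ty C) → Der Γ (tm d (C.inst₂ a (refl a))) →
      Der Γ (eqTm (J C d (refl a)) d (C.inst₂ a (refl a)))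
  -- Binary coproduct types
  | Sum_ty {Γ A B} : Der Γ (ty A) → Der Γ (ty B) → Der Γ (ty (Sum A B))
  | Sum_eqTy {Γ A A' B B'} : Der Γ (eqTy A A') → Der Γ (eqTy B B') →
      Der Γ (eqTy (Sum A B) (Sum A' B'))
  | Sum_U {Γ A B} : Der Γ (tm A U) → Der Γ (tm B U) → Der Γ (tm (Sum A B) U)
  | Sum_eqU {Γ A A' B B'} : Der Γ (eqTm A A' U) → Der Γ (eqTm B B' U) →
      Der Γ (eqTm (Sum A B) (Sum A' B') U)
  | inl {Γ A B a} : Der Γ (ty B) → Der Γ (tm a A) → Der Γ (tm (inl a) (Sum A B))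
  | inl_eq {Γ A B a a'} : Der Γ (ty B) → Der Γ (eqTm a a' A) →
      Der Γ (eqTm (inl a) (inl a') (Sum A B))
  | inr {Γ A B b} : Der Γ (ty A) → Der Γ (tm b B) → Der Γ (tm (inr b) (Sum A B))
  | inr_eq {Γ A B b b'} : Der Γ (ty A) → Der Γ (eqTm b b' B) →
      Der Γ (eqTm (inr b) (inr b') (Sum A B))
  | case {Γ A B C l r s} : Der (Sum A B :: Γ) (ty C) →
      Der (A :: Γ) (tm l (C.replace (inl (var 0)))) →
      Der (B :: Γ) (tm r (C.replace (inr (var 0)))) →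
      Der Γ (tm s (Sum A B)) → Der Γ (tm (case C l r s) (C.inst s))
  | case_eq {Γ A B C C' l l' r r' s s'} : Der (Sum A B :: Γ) (eqTy C C') →
      Der (A :: Γ) (eqTm l l' (C.replace (inl (var 0)))) →
      Der (B :: Γ) (eqTm r r' (C.replace (inr (var 0)))) →
      Der Γ (eqTm s s' (Sum A B)) → Der Γ (eqTm (case C l r s) (case C' l' r' s') (C.inst s))
  | inl_beta {Γ A B C l r a} : Der (Sum A B :: Γ) (ty C) →
      Der (A :: Γ) (tm l (C.replace (inl (var 0)))) →
      Der (B :: Γ) (tm r (C.replace (inr (var 0)))) →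
      Der Γ (tm a A) → Der Γ (eqTm (case C l r (inl a)) (l.inst a) (C.inst (inl a)))
  | inr_beta {Γ A B C l r b} : Der (Sum A B :: Γ) (ty C) →
      Der (A :: Γ) (tm l (C.replace (inl (var 0)))) →
      Der (B :: Γ) (tm r (C.replace (inr (var 0)))) →
      Der Γ (tm b B) → Der Γ (eqTm (case C l r (inr b)) (r.inst b) (C.inst (inr b)))
  -- The empty type
  | Empty_ty {Γ} : Der Γ ctx → Der Γ (ty Empty)
  | Empty_U {Γ} : Der Γ ctx → Der Γ (tm Empty U)
  | absurd {Γ C e} : Der (Empty :: Γ) (ty C) → Der Γ (tm e Empty) →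
      Der Γ (tm (absurd C e) (C.inst e))
  | absurd_eq {Γ C C' e e'} : Der (Empty :: Γ) (eqTy C C') → Der Γ (eqTm e e' Empty) →
      Der Γ (eqTm (absurd C e) (absurd C' e') (C.inst e))
  -- The unit type (its eliminator is definable from the strict `η` rule)
  | Unit_ty {Γ} : Der Γ ctx → Der Γ (ty Unit)
  | Unit_U {Γ} : Der Γ ctx → Der Γ (tm Unit U)
  | star {Γ} : Der Γ ctx → Der Γ (tm star Unit)
  | Unit_eta {Γ a} : Der Γ (tm a Unit) → Der Γ (eqTm a star Unit)

/-- `ITT ⊢ A`: some closed term has type `A`. -/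
def Provable (A : Tm) : Prop := ∃ t : Tm, Der [] (tm t A)

/-! ## The principles

The following are operations on expressions over an arbitrary context `Γ`; an argument `B`
described as a family over `A` is an expression over `Γ, x : A`. -/

/-- `A → B` -/
def arrow (A B : Tm) : Tm := Pi A B.wk

/-- `A × B` -/
def prod (A B : Tm) : Tm := Sig A B.wk

/-- Logical equivalence `A ↔ B`. -/
def iff (A B : Tm) : Tm := prod (arrow A B) (arrow B A)

/-- The weakening of a family `B` over `A` by one variable inserted before `x : A`. -/
def wkFam (B : Tm) : Tm := B.rename (liftRen (· + 1))

/-- The identity function of `A`. -/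
def idFun (A : Tm) : Tm := lam A (var 0)

/-- The composite of `f : A → B` and `g : B → C`, that is, `λ (x : A), g (f x)`. -/
def comp (A g f : Tm) : Tm := lam A (app g.wk (app f.wk (var 0)))

/-- The type `f ∼ g` of homotopies, `Π (x : A), f x =_{B x} g x`, for a family `B` over `A` and
`f g : Π (x : A), B x`. -/
def htpy (A B f g : Tm) : Tm := Pi A (Id B (app f.wk (var 0)) (app g.wk (var 0)))

/-- For `f : A → B`, the type `(Σ (s : B → A), f ∘ s ∼ id) × (Σ (r : B → A), r ∘ f ∼ id)`. -/
def isEquiv (A B f : Tm) : Tm :=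
  prod
    (Sig (arrow B A) (htpy B.wk B.wk.wk (comp B.wk f.wk (var 0)) (idFun B.wk)))
    (Sig (arrow B A) (htpy A.wk A.wk.wk (comp A.wk (var 0) f.wk) (idFun A.wk)))

/-- The type `A ≃ B` of (homotopy) equivalences. -/
def equiv (A B : Tm) : Tm := Sig (arrow A B) (isEquiv A.wk B.wk (var 0))

/-- For `f : A → B`, the type `(Σ (s : B → A), f ∘ s = id) × (Σ (r : B → A), r ∘ f = id)`. -/
def isCatEquiv (A B f : Tm) : Tm :=
  prod
    (Sig (arrow B A) (Id (arrow B.wk B.wk) (comp B.wk f.wk (var 0)) (idFun B.wk)))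
    (Sig (arrow B A) (Id (arrow A.wk A.wk) (comp A.wk (var 0) f.wk) (idFun A.wk)))

/-- The type `A ≅ B` of categorical equivalences. -/
def catEquiv (A B : Tm) : Tm := Sig (arrow A B) (isCatEquiv A.wk B.wk (var 0))

/-- The homotopy `id ∘ id ∼ id`, given by reflexivity. -/
def idHtpy (A : Tm) : Tm := lam A (refl (var 0))

/-- The identity equivalence `A ≃ A`. -/
def idEquiv (A : Tm) : Tm :=
  pair (idFun A) (pair (pair (idFun A) (idHtpy A)) (pair (idFun A) (idHtpy A)))

/-- The identity categorical equivalence `A ≅ A`. -/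
def idCatEquiv (A : Tm) : Tm :=
  pair (idFun A) (pair (pair (idFun A) (refl (idFun A))) (pair (idFun A) (refl (idFun A))))

/-- The map `(A =_U B) → (A ≃ B)`, defined by path induction with `refl ↦ idEquiv A`. -/
def idToEquiv (A B : Tm) : Tm :=
  lam (Id U A B) (J (equiv A.wk.wk.wk (var 1)) (idEquiv A.wk) (var 0))

/-- The map `(A =_U B) → (A ≅ B)`, defined by path induction with `refl ↦ idCatEquiv A`. -/
def idToCatEquiv (A B : Tm) : Tm :=
  lam (Id U A B) (J (catEquiv A.wk.wk.wk (var 1)) (idCatEquiv A.wk) (var 0))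

/-- For a family `B` over `A` and `f g : Π (x : A), B x`, the map `(f = g) → (f ∼ g)`, defined by
path induction with `refl ↦ λ (x : A), refl (f x)`. -/
def idToHtpy (A B f g : Tm) : Tm :=
  lam (Id (Pi A B) f g)
    (J (htpy A.wk.wk.wk (wkFam (wkFam (wkFam B))) f.wk.wk.wk (var 1))
      (lam A.wk (refl (app f.wk.wk (var 0)))) (var 0))

/-- Univalence: for all `A B : U`, the map `(A =_U B) → (A ≃ B)` is an equivalence. -/
def UA : Tm :=
  Pi U (Pi U
    (isEquiv (Id U (var 1) (var 0)) (equiv (var 1) (var 0)) (idToEquiv (var 1) (var 0))))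

/-- Categorical univalence: for all `A B : U`, the map `(A =_U B) → (A ≅ B)` is an equivalence. -/
def CUA : Tm :=
  Pi U (Pi U
    (isEquiv (Id U (var 1) (var 0)) (catEquiv (var 1) (var 0)) (idToCatEquiv (var 1) (var 0))))

/-- Function extensionality in `U`: for all `A : U`, `B : A → U` and `f g : Π (x : A), B x`, the map
`(f = g) → (f ∼ g)` is an equivalence. -/
def FE : Tm :=
  Pi U (Pi (arrow (var 0) U)
    (Pi (Pi (var 1) (app (var 1) (var 0))) (Pi (Pi (var 2) (app (var 2) (var 0)))
      (isEquiv (Id (Pi (var 3) (app (var 3) (var 0))) (var 1) (var 0))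
        (htpy (var 3) (app (var 3) (var 0)) (var 1) (var 0))
        (idToHtpy (var 3) (app (var 3) (var 0)) (var 1) (var 0))))))

end ITT

/-! The mathematical argument rests on three facts. First, univalence gives function extensionality.
For `f : Π x, B x`, the type `W` of triples `(x, y, f x = y)` projects to `A` by an equivalence,
since singletons are contractible. By univalence this equivalence may be replaced by an identity
function, so the fibres of postcomposition with it are propositions. A homotopy `h : f ∼ g` is an
element of the fibre over `id`, as is the trivial homotopy on `f`; a path between them gives a path
`f = g` that induces `h` (`HTm.naiveFunext`). Correcting by a loop turns this section of `(f = g) →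
(f ∼ g)` into a retraction as well (`HTm.funextOfNaive`). Second, under function extensionality the
forgetful map from `A ≅ B` to `A ≃ B` is invertible: it keeps the three functions and is a fibrewise
equivalence on the two proofs (`HTm.totalInvertible`, `HTm.forgetInvertible`). Third, this map sends
the identity strictly to the identity, so by path induction it commutes with the maps out of `A =
B`. Two-out-of-three then transfers univalence in either direction (`HTm.transferForward`,
`HTm.transferBackward`).

The theorem asserts derivability in a formal calculus, so the terms expressing this argument also
need derivations. These come by reflection: a fuelled bidirectional checker computes `β`-`η` normal
forms and compares types syntactically, and `derives_sound` turns each successful run into a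
derivation. Only soundness is proved, not completeness or termination. It rests on stability under
substitution (`SubClass.stable`), congruence under strictly equal substitutions (`Der.functional`)
and presuppositions (`Der.regular`). A `β` step on a `λ` would ordinarily invert its typing, which
calls for injectivity of `Π` up to strict equality. The checker avoids this metatheorem: whenever it
returns an introduction form, soundness also provides typing evidence matching the returned type
literally (`Canonical`). -/

namespace ITT

open Tm Judgment

namespace Tm

/-! ## The substitution calculus -/

attribute [simp] subst

@[simp] theorem liftSub_zero (σ : ℕ → Tm) : liftSub σ 0 = var 0 := rfl

@[simp] theorem liftSub_succ (σ : ℕ → Tm) (n : ℕ) : liftSub σ (n + 1) = (σ n).wk := rfl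

/-- Extend a substitution by a value for the last variable. -/
def scons (a : Tm) (σ : ℕ → Tm) : ℕ → Tm
  | 0 => a
  | n + 1 => σ n

@[simp] theorem scons_zero (a : Tm) (σ : ℕ → Tm) : scons a σ 0 = a := rfl

@[simp] theorem scons_succ (a : Tm) (σ : ℕ → Tm) (n : ℕ) : scons a σ (n + 1) = σ n := rfl

theorem inst_eq (t a : Tm) : t.inst a = t.subst (scons a var) := by
  unfold inst; congr 1

theorem inst₂_eq (t a b : Tm) : t.inst₂ a b = t.subst (scons b (scons a var)) := by
  unfold inst₂; congr 1; funext n; rcases n with _ | _ | n <;> rfl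

theorem replace_eq (t u : Tm) : t.replace u = t.subst (scons u fun n => var (n + 1)) := by
  unfold replace; congr 1

theorem liftSub_ren (ξ : ℕ → ℕ) :
    liftSub (fun n => var (ξ n)) = fun n => var (liftRen ξ n) := by
  funext n; cases n <;> rfl

theorem rename_eq_subst (ξ : ℕ → ℕ) (t : Tm) : t.rename ξ = t.subst fun n => var (ξ n) := by
  induction t generalizing ξ <;> simp_all [rename, liftSub_ren]

theorem wk_eq (t : Tm) : t.wk = t.subst fun n => var (n + 1) := rename_eq_subst _ t

@[simp] theorem liftSub_var : liftSub var = var := by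
  funext n; cases n <;> rfl

@[simp] theorem subst_var (t : Tm) : t.subst var = t := by
  induction t <;> simp_all

theorem rename_subst (ξ : ℕ → ℕ) (σ : ℕ → Tm) (t : Tm) :
    (t.rename ξ).subst σ = t.subst fun n => σ (ξ n) := by
  have lift (ξ : ℕ → ℕ) (σ : ℕ → Tm) :
      (fun n => liftSub σ (liftRen ξ n)) = liftSub fun n => σ (ξ n) := by
    funext n; cases n <;> rfl
  induction t generalizing ξ σ <;> simp_all [rename]

theorem subst_rename (ξ : ℕ → ℕ) (σ : ℕ → Tm) (t : Tm) :
    (t.subst σ).rename ξ = t.subst fun n => (σ n).rename ξ := by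
  have lift (ξ : ℕ → ℕ) (σ : ℕ → Tm) :
      (fun n => (liftSub σ n).rename (liftRen ξ)) = liftSub fun n => (σ n).rename ξ := by
    funext n
    cases n with
    | zero => rfl
    | succ n =>
      change ((σ n).rename (· + 1)).rename (liftRen ξ) = ((σ n).rename ξ).rename (· + 1)
      rw [rename_eq_subst (liftRen ξ), rename_subst, rename_eq_subst (· + 1) (rename ξ _),
        rename_subst]
      rfl
  induction t generalizing ξ σ <;> simp_all [rename]

theorem wk_subst (σ : ℕ → Tm) (t : Tm) : t.wk.subst σ = t.subst fun n => σ (n + 1) :=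
  rename_subst _ _ _

@[simp] theorem wk_subst_liftSub (σ : ℕ → Tm) (t : Tm) :
    t.wk.subst (liftSub σ) = (t.subst σ).wk := by
  rw [wk_subst, wk, subst_rename]; rfl

theorem subst_subst (σ τ : ℕ → Tm) (t : Tm) :
    (t.subst σ).subst τ = t.subst fun n => (σ n).subst τ := by
  have lift (σ τ : ℕ → Tm) :
      (fun n => (liftSub σ n).subst (liftSub τ)) = liftSub fun n => (σ n).subst τ := by
    funext n
    cases n with
    | zero => rfl
    | succ n => exact wk_subst_liftSub τ (σ n)
  induction t generalizing σ τ <;> simp_all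

@[simp] theorem wk_subst_scons (a : Tm) (σ : ℕ → Tm) (t : Tm) :
    t.wk.subst (scons a σ) = t.subst σ := wk_subst _ _

@[simp] theorem wk_inst (a t : Tm) : t.wk.inst a = t := by simp [inst_eq]

theorem subst_liftSub_scons (σ τ : ℕ → Tm) (t a : Tm) :
    (t.subst (liftSub σ)).subst (scons a τ) = t.subst (scons a fun n => (σ n).subst τ) := by
  rw [subst_subst]; congr 1; funext n; cases n <;> simp [scons, liftSub]

theorem subst_liftSub_inst (σ : ℕ → Tm) (t a : Tm) :
    (t.subst (liftSub σ)).inst a = t.subst (scons a σ) := by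
  rw [inst_eq, subst_liftSub_scons]; simp

theorem subst_liftSub_inst₂ (σ : ℕ → Tm) (t a b : Tm) :
    (t.subst (liftSub (liftSub σ))).inst₂ a b = t.subst (scons b (scons a σ)) := by
  rw [inst₂_eq, subst_liftSub_scons]; congr 2; funext n; cases n <;> simp [scons, liftSub]

theorem inst_subst' (σ : ℕ → Tm) (t a : Tm) :
    (t.inst a).subst σ = t.subst (scons (a.subst σ) σ) := by
  rw [inst_eq, subst_subst]; congr 1; funext n; cases n <;> rfl

theorem inst₂_subst' (σ : ℕ → Tm) (t a b : Tm) :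
    (t.inst₂ a b).subst σ = t.subst (scons (b.subst σ) (scons (a.subst σ) σ)) := by
  rw [inst₂_eq, subst_subst]; congr 1; funext n; rcases n with _ | _ | n <;> rfl

@[simp] theorem inst_subst (σ : ℕ → Tm) (t a : Tm) :
    (t.inst a).subst σ = (t.subst (liftSub σ)).inst (a.subst σ) := by
  rw [inst_subst', subst_liftSub_inst]

@[simp] theorem inst₂_subst (σ : ℕ → Tm) (t a b : Tm) :
    (t.inst₂ a b).subst σ = (t.subst (liftSub (liftSub σ))).inst₂ (a.subst σ) (b.subst σ) := by
  rw [inst₂_subst', subst_liftSub_inst₂]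

@[simp] theorem replace_subst (σ : ℕ → Tm) (t u : Tm) :
    (t.replace u).subst (liftSub σ) = (t.subst (liftSub σ)).replace (u.subst (liftSub σ)) := by
  rw [replace_eq, replace_eq, subst_subst, subst_liftSub_scons]
  congr 1; funext n; cases n
  · rfl
  · simp only [scons, Tm.subst, liftSub, wk_eq]

end Tm

/-! ## Admissibility of substitution -/

/-- Apply a substitution to a judgment. -/
def Judgment.subst (σ : ℕ → Tm) : Judgment → Judgment
  | ctx => ctx
  | ty A => ty (A.subst σ)
  | tm a A => tm (a.subst σ) (A.subst σ)
  | eqTy A B => eqTy (A.subst σ) (B.subst σ)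
  | eqTm a b A => eqTm (a.subst σ) (b.subst σ) (A.subst σ)

attribute [simp] Judgment.subst

/-- Every type in a context satisfies a predicate. -/
def CtxAll (R : Ctx → Tm → Prop) : Ctx → Prop
  | [] => True
  | A :: Γ => R Γ A ∧ CtxAll R Γ

/-- A class of substitutions between contexts, closed under extension by a variable. -/
structure SubClass where
  mem : Ctx → Ctx → (ℕ → Tm) → Prop
  var {Γ Δ σ n A} : mem Γ Δ σ → Der Δ ctx → Lookup Γ n A → Der Δ (tm (σ n) (A.subst σ))
  lift {Γ Δ σ A} : mem Γ Δ σ → Der Δ (ty (A.subst σ)) → Der Δ ctx →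
    mem (A :: Γ) (A.subst σ :: Δ) (liftSub σ)

namespace SubClass

variable (P : SubClass)

def StableTy (Γ : Ctx) (A : Tm) : Prop :=
  ∀ ⦃Δ σ⦄, Der Δ ctx → P.mem Γ Δ σ → Der Δ (ty (A.subst σ))

/-- Several rules bind a variable without a premise that its type is well formed, for instance the
branches of `case`. Going under such a binder needs the substituted type to be well formed, so the
induction carries this for every type of the context. -/
def Stable (Γ : Ctx) (𝒥 : Judgment) : Prop :=
  CtxAll P.StableTy Γ ∧ ∀ ⦃Δ σ⦄, Der Δ ctx → P.mem Γ Δ σ → Der Δ (𝒥.subst σ)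

variable {P}

theorem Stable.under {Γ A 𝒥} (h : P.Stable (A :: Γ) 𝒥) {Δ σ} (hΔ : Der Δ ctx)
    (hσ : P.mem Γ Δ σ) : Der (A.subst σ :: Δ) (𝒥.subst (liftSub σ)) :=
  have hA := h.1.1 hΔ hσ
  h.2 (.cons hΔ hA) (P.lift hσ hA hΔ)

theorem Stable.under₂ {Γ A B 𝒥} (h : P.Stable (B :: A :: Γ) 𝒥) {Δ σ} (hΔ : Der Δ ctx)
    (hσ : P.mem Γ Δ σ) :
    Der (B.subst (liftSub σ) :: A.subst σ :: Δ) (𝒥.subst (liftSub (liftSub σ))) :=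
  have hA := h.1.2.1 hΔ hσ
  have hB := h.1.1 (.cons hΔ hA) (P.lift hσ hA hΔ)
  h.2 (.cons (.cons hΔ hA) hB) (P.lift (P.lift hσ hA hΔ) hB (.cons hΔ hA))

end SubClass

/-- Derivability is stable under any class of substitutions closed under extension. -/
theorem SubClass.stable (P : SubClass) {Γ 𝒥} (h : Der Γ 𝒥) : P.Stable Γ 𝒥 := by
  induction h with
  | nil => exact ⟨trivial, fun Δ σ hΔ hσ => hΔ⟩
  | cons _ _ ih₁ ih₂ => exact ⟨⟨ih₂.2, ih₁.1⟩, fun Δ σ hΔ hσ => hΔ⟩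
  | var _ hn ih₁ => exact ⟨ih₁.1, fun Δ σ hΔ hσ => P.var hσ hΔ hn⟩
  | ty_rfl _ ih₁ =>
    exact ⟨ih₁.1, fun Δ σ hΔ hσ => Der.ty_rfl (ih₁.2 hΔ hσ)⟩
  | ty_symm _ ih₁ =>
    exact ⟨ih₁.1, fun Δ σ hΔ hσ => Der.ty_symm (ih₁.2 hΔ hσ)⟩
  | ty_trans _ _ ih₁ ih₂ =>
    exact ⟨ih₁.1, fun Δ σ hΔ hσ => Der.ty_trans (ih₁.2 hΔ hσ) (ih₂.2 hΔ hσ)⟩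
  | tm_rfl _ ih₁ =>
    exact ⟨ih₁.1, fun Δ σ hΔ hσ => Der.tm_rfl (ih₁.2 hΔ hσ)⟩
  | tm_symm _ ih₁ =>
    exact ⟨ih₁.1, fun Δ σ hΔ hσ => Der.tm_symm (ih₁.2 hΔ hσ)⟩
  | tm_trans _ _ ih₁ ih₂ =>
    exact ⟨ih₁.1, fun Δ σ hΔ hσ => Der.tm_trans (ih₁.2 hΔ hσ) (ih₂.2 hΔ hσ)⟩
  | conv _ _ ih₁ ih₂ =>
    exact ⟨ih₁.1, fun Δ σ hΔ hσ => Der.conv (ih₁.2 hΔ hσ) (ih₂.2 hΔ hσ)⟩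
  | conv_eq _ _ ih₁ ih₂ =>
    exact ⟨ih₁.1, fun Δ σ hΔ hσ => Der.conv_eq (ih₁.2 hΔ hσ) (ih₂.2 hΔ hσ)⟩
  | U_ty _ ih₁ =>
    exact ⟨ih₁.1, fun Δ σ hΔ hσ => Der.U_ty (ih₁.2 hΔ hσ)⟩
  | el _ ih₁ =>
    exact ⟨ih₁.1, fun Δ σ hΔ hσ => Der.el (ih₁.2 hΔ hσ)⟩
  | el_eq _ ih₁ =>
    exact ⟨ih₁.1, fun Δ σ hΔ hσ => Der.el_eq (ih₁.2 hΔ hσ)⟩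
  | Pi_ty _ _ ih₁ ih₂ =>
    exact ⟨ih₁.1, fun Δ σ hΔ hσ => Der.Pi_ty (ih₁.2 hΔ hσ) (ih₂.under hΔ hσ)⟩
  | Pi_eqTy _ _ _ ih₁ ih₂ ih₃ =>
    exact ⟨ih₁.1, fun Δ σ hΔ hσ => Der.Pi_eqTy (ih₁.2 hΔ hσ) (ih₂.2 hΔ hσ) (ih₃.under hΔ hσ)⟩
  | Pi_U _ _ ih₁ ih₂ =>
    exact ⟨ih₁.1, fun Δ σ hΔ hσ => Der.Pi_U (ih₁.2 hΔ hσ) (ih₂.under hΔ hσ)⟩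
  | Pi_eqU _ _ _ ih₁ ih₂ ih₃ =>
    exact ⟨ih₁.1, fun Δ σ hΔ hσ => Der.Pi_eqU (ih₁.2 hΔ hσ) (ih₂.2 hΔ hσ) (ih₃.under hΔ hσ)⟩
  | lam _ _ ih₁ ih₂ =>
    exact ⟨ih₁.1, fun Δ σ hΔ hσ => Der.lam (ih₁.2 hΔ hσ) (ih₂.under hΔ hσ)⟩
  | lam_eq _ _ _ ih₁ ih₂ ih₃ =>
    exact ⟨ih₁.1, fun Δ σ hΔ hσ => Der.lam_eq (ih₁.2 hΔ hσ) (ih₂.2 hΔ hσ) (ih₃.under hΔ hσ)⟩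
  | app _ _ ih₁ ih₂ =>
    exact ⟨ih₁.1, fun Δ σ hΔ hσ => by
      simpa using Der.app (ih₁.2 hΔ hσ) (ih₂.2 hΔ hσ)⟩
  | app_eq _ _ ih₁ ih₂ =>
    exact ⟨ih₁.1, fun Δ σ hΔ hσ => by
      simpa using Der.app_eq (ih₁.2 hΔ hσ) (ih₂.2 hΔ hσ)⟩
  | Pi_beta _ _ _ ih₁ ih₂ ih₃ =>
    exact ⟨ih₁.1, fun Δ σ hΔ hσ => by
      simpa using Der.Pi_beta (ih₁.2 hΔ hσ) (ih₂.under hΔ hσ) (ih₃.2 hΔ hσ)⟩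
  | Pi_eta _ ih₁ =>
    exact ⟨ih₁.1, fun Δ σ hΔ hσ => by
      simpa using Der.Pi_eta (ih₁.2 hΔ hσ)⟩
  | Sig_ty _ _ ih₁ ih₂ =>
    exact ⟨ih₁.1, fun Δ σ hΔ hσ => Der.Sig_ty (ih₁.2 hΔ hσ) (ih₂.under hΔ hσ)⟩
  | Sig_eqTy _ _ _ ih₁ ih₂ ih₃ =>
    exact ⟨ih₁.1, fun Δ σ hΔ hσ => Der.Sig_eqTy (ih₁.2 hΔ hσ) (ih₂.2 hΔ hσ) (ih₃.under hΔ hσ)⟩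
  | Sig_U _ _ ih₁ ih₂ =>
    exact ⟨ih₁.1, fun Δ σ hΔ hσ => Der.Sig_U (ih₁.2 hΔ hσ) (ih₂.under hΔ hσ)⟩
  | Sig_eqU _ _ _ ih₁ ih₂ ih₃ =>
    exact ⟨ih₁.1, fun Δ σ hΔ hσ => Der.Sig_eqU (ih₁.2 hΔ hσ) (ih₂.2 hΔ hσ) (ih₃.under hΔ hσ)⟩
  | pair _ _ _ ih₁ ih₂ ih₃ =>
    exact ⟨ih₂.1, fun Δ σ hΔ hσ =>
      Der.pair (ih₁.under hΔ hσ) (ih₂.2 hΔ hσ) (by simpa using ih₃.2 hΔ hσ)⟩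
  | pair_eq _ _ _ ih₁ ih₂ ih₃ =>
    exact ⟨ih₂.1, fun Δ σ hΔ hσ =>
      Der.pair_eq (ih₁.under hΔ hσ) (ih₂.2 hΔ hσ) (by simpa using ih₃.2 hΔ hσ)⟩
  | fst _ ih₁ =>
    exact ⟨ih₁.1, fun Δ σ hΔ hσ => Der.fst (ih₁.2 hΔ hσ)⟩
  | fst_eq _ ih₁ =>
    exact ⟨ih₁.1, fun Δ σ hΔ hσ => Der.fst_eq (ih₁.2 hΔ hσ)⟩
  | snd _ ih₁ =>
    exact ⟨ih₁.1, fun Δ σ hΔ hσ => by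
      simpa using Der.snd (ih₁.2 hΔ hσ)⟩
  | snd_eq _ ih₁ =>
    exact ⟨ih₁.1, fun Δ σ hΔ hσ => by
      simpa using Der.snd_eq (ih₁.2 hΔ hσ)⟩
  | fst_beta _ _ _ ih₁ ih₂ ih₃ =>
    exact ⟨ih₂.1, fun Δ σ hΔ hσ =>
      Der.fst_beta (ih₁.under hΔ hσ) (ih₂.2 hΔ hσ) (by simpa using ih₃.2 hΔ hσ)⟩
  | snd_beta _ _ _ ih₁ ih₂ ih₃ =>
    exact ⟨ih₂.1, fun Δ σ hΔ hσ => by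
      simpa using Der.snd_beta (ih₁.under hΔ hσ) (ih₂.2 hΔ hσ) (by simpa using ih₃.2 hΔ hσ)⟩
  | Sig_eta _ ih₁ =>
    exact ⟨ih₁.1, fun Δ σ hΔ hσ => Der.Sig_eta (ih₁.2 hΔ hσ)⟩
  | Id_ty _ _ _ ih₁ ih₂ ih₃ =>
    exact ⟨ih₁.1, fun Δ σ hΔ hσ => Der.Id_ty (ih₁.2 hΔ hσ) (ih₂.2 hΔ hσ) (ih₃.2 hΔ hσ)⟩
  | Id_eqTy _ _ _ ih₁ ih₂ ih₃ =>
    exact ⟨ih₁.1, fun Δ σ hΔ hσ => Der.Id_eqTy (ih₁.2 hΔ hσ) (ih₂.2 hΔ hσ) (ih₃.2 hΔ hσ)⟩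
  | Id_U _ _ _ ih₁ ih₂ ih₃ =>
    exact ⟨ih₁.1, fun Δ σ hΔ hσ => Der.Id_U (ih₁.2 hΔ hσ) (ih₂.2 hΔ hσ) (ih₃.2 hΔ hσ)⟩
  | Id_eqU _ _ _ ih₁ ih₂ ih₃ =>
    exact ⟨ih₁.1, fun Δ σ hΔ hσ => Der.Id_eqU (ih₁.2 hΔ hσ) (ih₂.2 hΔ hσ) (ih₃.2 hΔ hσ)⟩
  | refl _ ih₁ =>
    exact ⟨ih₁.1, fun Δ σ hΔ hσ => Der.refl (ih₁.2 hΔ hσ)⟩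
  | refl_eq _ ih₁ =>
    exact ⟨ih₁.1, fun Δ σ hΔ hσ => Der.refl_eq (ih₁.2 hΔ hσ)⟩
  | J _ _ _ _ _ ih₁ ih₂ ih₃ ih₄ ih₅ =>
    exact ⟨ih₁.1, fun Δ σ hΔ hσ => by
      simpa using Der.J (ih₁.2 hΔ hσ) (by simpa using ih₂.under₂ hΔ hσ) (by simpa using ih₃.2 hΔ hσ) (ih₄.2 hΔ hσ) (ih₅.2 hΔ hσ)⟩
  | J_eq _ _ _ _ _ ih₁ ih₂ ih₃ ih₄ ih₅ =>
    exact ⟨ih₁.1, fun Δ σ hΔ hσ => by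
      simpa using Der.J_eq (ih₁.2 hΔ hσ) (by simpa using ih₂.under₂ hΔ hσ) (by simpa using ih₃.2 hΔ hσ) (ih₄.2 hΔ hσ) (ih₅.2 hΔ hσ)⟩
  | J_beta _ _ _ ih₁ ih₂ ih₃ =>
    exact ⟨ih₁.1, fun Δ σ hΔ hσ => by
      simpa using Der.J_beta (ih₁.2 hΔ hσ) (by simpa using ih₂.under₂ hΔ hσ) (by simpa using ih₃.2 hΔ hσ)⟩
  | Sum_ty _ _ ih₁ ih₂ =>
    exact ⟨ih₁.1, fun Δ σ hΔ hσ => Der.Sum_ty (ih₁.2 hΔ hσ) (ih₂.2 hΔ hσ)⟩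
  | Sum_eqTy _ _ ih₁ ih₂ =>
    exact ⟨ih₁.1, fun Δ σ hΔ hσ => Der.Sum_eqTy (ih₁.2 hΔ hσ) (ih₂.2 hΔ hσ)⟩
  | Sum_U _ _ ih₁ ih₂ =>
    exact ⟨ih₁.1, fun Δ σ hΔ hσ => Der.Sum_U (ih₁.2 hΔ hσ) (ih₂.2 hΔ hσ)⟩
  | Sum_eqU _ _ ih₁ ih₂ =>
    exact ⟨ih₁.1, fun Δ σ hΔ hσ => Der.Sum_eqU (ih₁.2 hΔ hσ) (ih₂.2 hΔ hσ)⟩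
  | inl _ _ ih₁ ih₂ =>
    exact ⟨ih₁.1, fun Δ σ hΔ hσ => Der.inl (ih₁.2 hΔ hσ) (ih₂.2 hΔ hσ)⟩
  | inl_eq _ _ ih₁ ih₂ =>
    exact ⟨ih₁.1, fun Δ σ hΔ hσ => Der.inl_eq (ih₁.2 hΔ hσ) (ih₂.2 hΔ hσ)⟩
  | inr _ _ ih₁ ih₂ =>
    exact ⟨ih₁.1, fun Δ σ hΔ hσ => Der.inr (ih₁.2 hΔ hσ) (ih₂.2 hΔ hσ)⟩
  | inr_eq _ _ ih₁ ih₂ =>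
    exact ⟨ih₁.1, fun Δ σ hΔ hσ => Der.inr_eq (ih₁.2 hΔ hσ) (ih₂.2 hΔ hσ)⟩
  | case _ _ _ _ ih₁ ih₂ ih₃ ih₄ =>
    exact ⟨ih₄.1, fun Δ σ hΔ hσ => by
      simpa using Der.case (ih₁.under hΔ hσ) (by simpa using ih₂.under hΔ hσ) (by simpa using ih₃.under hΔ hσ) (ih₄.2 hΔ hσ)⟩
  | case_eq _ _ _ _ ih₁ ih₂ ih₃ ih₄ =>
    exact ⟨ih₄.1, fun Δ σ hΔ hσ => by
      simpa using Der.case_eq (ih₁.under hΔ hσ) (by simpa using ih₂.under hΔ hσ) (by simpa using ih₃.under hΔ hσ) (ih₄.2 hΔ hσ)⟩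
  | inl_beta _ _ _ _ ih₁ ih₂ ih₃ ih₄ =>
    exact ⟨ih₄.1, fun Δ σ hΔ hσ => by
      simpa using Der.inl_beta (ih₁.under hΔ hσ) (by simpa using ih₂.under hΔ hσ) (by simpa using ih₃.under hΔ hσ) (ih₄.2 hΔ hσ)⟩
  | inr_beta _ _ _ _ ih₁ ih₂ ih₃ ih₄ =>
    exact ⟨ih₄.1, fun Δ σ hΔ hσ => by
      simpa using Der.inr_beta (ih₁.under hΔ hσ) (by simpa using ih₂.under hΔ hσ) (by simpa using ih₃.under hΔ hσ) (ih₄.2 hΔ hσ)⟩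
  | Empty_ty _ ih₁ =>
    exact ⟨ih₁.1, fun Δ σ hΔ hσ => Der.Empty_ty (ih₁.2 hΔ hσ)⟩
  | Empty_U _ ih₁ =>
    exact ⟨ih₁.1, fun Δ σ hΔ hσ => Der.Empty_U (ih₁.2 hΔ hσ)⟩
  | absurd _ _ ih₁ ih₂ =>
    exact ⟨ih₂.1, fun Δ σ hΔ hσ => by
      simpa using Der.absurd (ih₁.under hΔ hσ) (ih₂.2 hΔ hσ)⟩
  | absurd_eq _ _ ih₁ ih₂ =>
    exact ⟨ih₂.1, fun Δ σ hΔ hσ => by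
      simpa using Der.absurd_eq (ih₁.under hΔ hσ) (ih₂.2 hΔ hσ)⟩
  | Unit_ty _ ih₁ =>
    exact ⟨ih₁.1, fun Δ σ hΔ hσ => Der.Unit_ty (ih₁.2 hΔ hσ)⟩
  | Unit_U _ ih₁ =>
    exact ⟨ih₁.1, fun Δ σ hΔ hσ => Der.Unit_U (ih₁.2 hΔ hσ)⟩
  | star _ ih₁ =>
    exact ⟨ih₁.1, fun Δ σ hΔ hσ => Der.star (ih₁.2 hΔ hσ)⟩
  | Unit_eta _ ih₁ =>
    exact ⟨ih₁.1, fun Δ σ hΔ hσ => Der.Unit_eta (ih₁.2 hΔ hσ)⟩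

/-! ### Renaming, weakening and typed substitution -/

/-- The class of renamings. -/
def SubClass.ren : SubClass where
  mem Γ Δ σ := ∃ ξ : ℕ → ℕ, (σ = fun n => Tm.var (ξ n)) ∧
    ∀ ⦃n A⦄, Lookup Γ n A → Lookup Δ (ξ n) (A.subst σ)
  var := by
    rintro Γ Δ _ n A ⟨ξ, rfl, h⟩ hΔ hn
    exact .var hΔ (h hn)
  lift := by
    rintro Γ Δ _ A ⟨ξ, rfl, h⟩ hA hΔ
    refine ⟨liftRen ξ, by funext n; cases n <;> rfl, fun n B hn => ?_⟩
    cases hn with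
    | here => simpa [liftRen] using Lookup.here Δ _
    | there _ hn => simpa [liftRen] using Lookup.there _ (h hn)

theorem Der.weaken {Γ A 𝒥} (h : Der Γ 𝒥) (hA : Der (A :: Γ) ctx) :
    Der (A :: Γ) (𝒥.subst fun n => Tm.var (n + 1)) :=
  (SubClass.ren.stable h).2 hA
    ⟨fun n => n + 1, rfl, fun n B hn => by simpa [wk_eq] using Lookup.there A hn⟩

/-- Typed substitutions. -/
def Sub (Γ Δ : Ctx) (σ : ℕ → Tm) : Prop :=
  ∀ ⦃n A⦄, Lookup Γ n A → Der Δ (tm (σ n) (A.subst σ))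

theorem Der.ctx {Γ 𝒥} (h : Der Γ 𝒥) : Der Γ ctx := by
  induction h <;> first | assumption | (constructor <;> assumption)

theorem Der.head {Γ A} (h : Der (A :: Γ) .ctx) : Der Γ (ty A) := by
  cases h; assumption

theorem Der.tail {Γ A} (h : Der (A :: Γ) .ctx) : Der Γ .ctx := by
  cases h; assumption

theorem Der.wk_ty {Γ A B} (h : Der Γ (ty B)) (hA : Der Γ (ty A)) : Der (A :: Γ) (ty B.wk) := by
  simpa [wk_eq] using h.weaken (.cons h.ctx hA)

theorem Der.wk_tm {Γ A b B} (h : Der Γ (tm b B)) (hA : Der Γ (ty A)) :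
    Der (A :: Γ) (tm b.wk B.wk) := by
  simpa [wk_eq] using h.weaken (.cons h.ctx hA)

theorem Der.wk_eqTy {Γ A B B'} (h : Der Γ (eqTy B B')) (hA : Der Γ (ty A)) :
    Der (A :: Γ) (eqTy B.wk B'.wk) := by
  simpa [wk_eq] using h.weaken (.cons h.ctx hA)

theorem Der.wk_eqTm {Γ A b b' B} (h : Der Γ (eqTm b b' B)) (hA : Der Γ (ty A)) :
    Der (A :: Γ) (eqTm b.wk b'.wk B.wk) := by
  simpa [wk_eq] using h.weaken (.cons h.ctx hA)

theorem Der.var_zero {Γ A} (hA : Der Γ (ty A)) : Der (A :: Γ) (tm (.var 0) A.wk) :=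
  .var (.cons hA.ctx hA) (.here Γ A)

/-- The class of typed substitutions. -/
def SubClass.sub : SubClass where
  mem := Sub
  var h _ hn := h hn
  -- Passing under a binder weakens the substituted terms, so weakening must already be available.
  -- This is why renamings form a separate, earlier instance.
  lift := by
    intro Γ Δ σ A h hA hΔ n B hn
    cases hn with
    | here => simpa using hA.var_zero
    | there _ hn => simpa using (h hn).wk_tm hA

theorem Der.subst {Γ Δ σ 𝒥} (h : Der Γ 𝒥) (hΔ : Der Δ .ctx) (hσ : Sub Γ Δ σ) :
    Der Δ (𝒥.subst σ) :=
  (SubClass.sub.stable h).2 hΔ hσ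

theorem Der.subst_under {Γ Δ σ A 𝒥} (h : Der (A :: Γ) 𝒥) (hΔ : Der Δ .ctx) (hσ : Sub Γ Δ σ) :
    Der (A.subst σ :: Δ) (𝒥.subst (liftSub σ)) :=
  (SubClass.sub.stable h).under hΔ hσ

theorem Sub.id {Γ} (h : Der Γ .ctx) : Sub Γ Γ .var := fun n A hn => by
  simpa using Der.var h hn

theorem Sub.scons {Γ Δ σ a A} (h : Sub Γ Δ σ) (ha : Der Δ (tm a (A.subst σ))) :
    Sub (A :: Γ) Δ (scons a σ) := fun n B hn => by
  cases hn with
  | here => simpa using ha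
  | there _ hn => simpa using h hn

/-! ### Congruence under strictly equal substitutions -/

/-- Pairs of strictly equal typed substitutions. -/
structure SubEq (Γ Δ : Ctx) (σ τ : ℕ → Tm) : Prop where
  left : Sub Γ Δ σ
  right : Sub Γ Δ τ
  eq : ∀ ⦃n A⦄, Lookup Γ n A → Der Δ (eqTm (σ n) (τ n) (A.subst σ))

theorem SubEq.lift {Γ Δ σ τ A} (h : SubEq Γ Δ σ τ) (hA : Der Δ (ty (A.subst σ)))
    (hA' : Der Δ (eqTy (A.subst σ) (A.subst τ))) :
    SubEq (A :: Γ) (A.subst σ :: Δ) (liftSub σ) (liftSub τ) where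
  left := SubClass.sub.lift h.left hA hA.ctx
  right n B hn := by
    cases hn with
    -- The target context is extended by the type under `σ`, so for `τ` the new variable has to be
    -- converted.
    | here => simpa using hA.var_zero.conv (hA'.wk_eqTy hA)
    | there _ hn => simpa using (h.right hn).wk_tm hA
  eq n B hn := by
    cases hn with
    | here => simpa using hA.var_zero.tm_rfl
    | there _ hn => simpa using (h.eq hn).wk_eqTm hA

/-- Types and terms send strictly equal substitutions to strictly equal results. -/
def FunctionalTy (Γ : Ctx) (A : Tm) : Prop :=
  Der Γ (ty A) ∧ ∀ ⦃Δ σ τ⦄, Der Δ ctx → SubEq Γ Δ σ τ → Der Δ (eqTy (A.subst σ) (A.subst τ))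

/-- Equality judgments are sent to the trivial `ctx`: only well-formed types and typed terms have a
congruence statement to prove. -/
def Judgment.congr (σ τ : ℕ → Tm) : Judgment → Judgment
  | ty A => eqTy (A.subst σ) (A.subst τ)
  | tm a A => eqTm (a.subst σ) (a.subst τ) (A.subst σ)
  | _ => ctx

attribute [simp] Judgment.congr

def Functional (Γ : Ctx) (𝒥 : Judgment) : Prop :=
  CtxAll FunctionalTy Γ ∧
    ∀ ⦃Δ σ τ⦄, Der Δ ctx → SubEq Γ Δ σ τ → Der Δ (𝒥.congr σ τ)

theorem Functional.under {Γ A 𝒥} (h : Functional (A :: Γ) 𝒥) {Δ σ τ} (hΔ : Der Δ ctx)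
    (hσ : SubEq Γ Δ σ τ) : Der (A.subst σ :: Δ) (𝒥.congr (liftSub σ) (liftSub τ)) :=
  have hA := h.1.1.1.subst hΔ hσ.left
  h.2 (.cons hΔ hA) (hσ.lift hA (h.1.1.2 hΔ hσ))

theorem Functional.under₂ {Γ A B 𝒥} (h : Functional (B :: A :: Γ) 𝒥) {Δ σ τ} (hΔ : Der Δ ctx)
    (hσ : SubEq Γ Δ σ τ) : Der (B.subst (liftSub σ) :: A.subst σ :: Δ)
      (𝒥.congr (liftSub (liftSub σ)) (liftSub (liftSub τ))) :=
  have hA := h.1.2.1.1.subst hΔ hσ.left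
  have hσ' := hσ.lift hA (h.1.2.1.2 hΔ hσ)
  have hΔ' := hΔ.cons hA
  have hB := h.1.1.1.subst hΔ' hσ'.left
  h.2 (.cons hΔ' hB) (hσ'.lift hB (h.1.1.2 hΔ' hσ'))

/-- Each formation or typing rule is answered by its congruence rule. The result serves dependent
instances: strictly equal arguments `a`, `a'` give strictly equal types `B.inst a`, `B.inst a'`. -/
theorem Der.functional {Γ 𝒥} (h : Der Γ 𝒥) : Functional Γ 𝒥 := by
  induction h with
  | nil => exact ⟨trivial, fun Δ σ τ hΔ hσ => hΔ⟩
  | cons _ h₂ ih₁ ih₂ => exact ⟨⟨⟨h₂, ih₂.2⟩, ih₁.1⟩, fun Δ σ τ hΔ hσ => hΔ⟩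
  | var _ hn ih₁ => exact ⟨ih₁.1, fun Δ σ τ hΔ hσ => hσ.eq hn⟩
  | ty_rfl _ ih₁ => exact ⟨ih₁.1, fun Δ σ τ hΔ hσ => hΔ⟩
  | ty_symm _ ih₁ => exact ⟨ih₁.1, fun Δ σ τ hΔ hσ => hΔ⟩
  | ty_trans _ _ ih₁ ih₂ => exact ⟨ih₁.1, fun Δ σ τ hΔ hσ => hΔ⟩
  | tm_rfl _ ih₁ => exact ⟨ih₁.1, fun Δ σ τ hΔ hσ => hΔ⟩
  | tm_symm _ ih₁ => exact ⟨ih₁.1, fun Δ σ τ hΔ hσ => hΔ⟩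
  | tm_trans _ _ ih₁ ih₂ => exact ⟨ih₁.1, fun Δ σ τ hΔ hσ => hΔ⟩
  | conv _ h₂ ih₁ _ =>
    exact ⟨ih₁.1, fun Δ σ τ hΔ hσ => Der.conv_eq (ih₁.2 hΔ hσ) (h₂.subst hΔ hσ.left)⟩
  | conv_eq _ _ ih₁ ih₂ => exact ⟨ih₁.1, fun Δ σ τ hΔ hσ => hΔ⟩
  | U_ty _ ih₁ => exact ⟨ih₁.1, fun Δ σ τ hΔ hσ => .ty_rfl (.U_ty hΔ)⟩
  | el _ ih₁ =>
    exact ⟨ih₁.1, fun Δ σ τ hΔ hσ => Der.el_eq (ih₁.2 hΔ hσ)⟩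
  | el_eq _ ih₁ => exact ⟨ih₁.1, fun Δ σ τ hΔ hσ => hΔ⟩
  | Pi_ty h₁ _ ih₁ ih₂ =>
    exact ⟨ih₁.1, fun Δ σ τ hΔ hσ =>
      Der.Pi_eqTy (h₁.subst hΔ hσ.left) (ih₁.2 hΔ hσ) (ih₂.under hΔ hσ)⟩
  | Pi_eqTy _ _ _ ih₁ ih₂ ih₃ => exact ⟨ih₁.1, fun Δ σ τ hΔ hσ => hΔ⟩
  | Pi_U h₁ _ ih₁ ih₂ =>
    exact ⟨ih₁.1, fun Δ σ τ hΔ hσ =>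
      Der.Pi_eqU (h₁.subst hΔ hσ.left) (ih₁.2 hΔ hσ) (ih₂.under hΔ hσ)⟩
  | Pi_eqU _ _ _ ih₁ ih₂ ih₃ => exact ⟨ih₁.1, fun Δ σ τ hΔ hσ => hΔ⟩
  | lam h₁ _ ih₁ ih₂ =>
    exact ⟨ih₁.1, fun Δ σ τ hΔ hσ =>
      Der.lam_eq (h₁.subst hΔ hσ.left) (ih₁.2 hΔ hσ) (ih₂.under hΔ hσ)⟩
  | lam_eq _ _ _ ih₁ ih₂ ih₃ => exact ⟨ih₁.1, fun Δ σ τ hΔ hσ => hΔ⟩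
  | app _ _ ih₁ ih₂ =>
    exact ⟨ih₁.1, fun Δ σ τ hΔ hσ => by
      simpa using Der.app_eq (ih₁.2 hΔ hσ) (ih₂.2 hΔ hσ)⟩
  | app_eq _ _ ih₁ ih₂ => exact ⟨ih₁.1, fun Δ σ τ hΔ hσ => hΔ⟩
  | Pi_beta _ _ _ ih₁ ih₂ ih₃ => exact ⟨ih₁.1, fun Δ σ τ hΔ hσ => hΔ⟩
  | Pi_eta _ ih₁ => exact ⟨ih₁.1, fun Δ σ τ hΔ hσ => hΔ⟩
  | Sig_ty h₁ _ ih₁ ih₂ =>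
    exact ⟨ih₁.1, fun Δ σ τ hΔ hσ =>
      Der.Sig_eqTy (h₁.subst hΔ hσ.left) (ih₁.2 hΔ hσ) (ih₂.under hΔ hσ)⟩
  | Sig_eqTy _ _ _ ih₁ ih₂ ih₃ => exact ⟨ih₁.1, fun Δ σ τ hΔ hσ => hΔ⟩
  | Sig_U h₁ _ ih₁ ih₂ =>
    exact ⟨ih₁.1, fun Δ σ τ hΔ hσ =>
      Der.Sig_eqU (h₁.subst hΔ hσ.left) (ih₁.2 hΔ hσ) (ih₂.under hΔ hσ)⟩
  | Sig_eqU _ _ _ ih₁ ih₂ ih₃ => exact ⟨ih₁.1, fun Δ σ τ hΔ hσ => hΔ⟩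
  | pair h₁ _ _ _ ih₂ ih₃ =>
    exact ⟨ih₂.1, fun Δ σ τ hΔ hσ =>
      Der.pair_eq (h₁.subst_under hΔ hσ.left) (ih₂.2 hΔ hσ) (by simpa using ih₃.2 hΔ hσ)⟩
  | pair_eq _ _ _ ih₁ ih₂ ih₃ => exact ⟨ih₂.1, fun Δ σ τ hΔ hσ => hΔ⟩
  | fst _ ih₁ =>
    exact ⟨ih₁.1, fun Δ σ τ hΔ hσ => Der.fst_eq (ih₁.2 hΔ hσ)⟩
  | fst_eq _ ih₁ => exact ⟨ih₁.1, fun Δ σ τ hΔ hσ => hΔ⟩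
  | snd _ ih₁ =>
    exact ⟨ih₁.1, fun Δ σ τ hΔ hσ => by
      simpa using Der.snd_eq (ih₁.2 hΔ hσ)⟩
  | snd_eq _ ih₁ => exact ⟨ih₁.1, fun Δ σ τ hΔ hσ => hΔ⟩
  | fst_beta _ _ _ ih₁ ih₂ ih₃ => exact ⟨ih₂.1, fun Δ σ τ hΔ hσ => hΔ⟩
  | snd_beta _ _ _ ih₁ ih₂ ih₃ => exact ⟨ih₂.1, fun Δ σ τ hΔ hσ => hΔ⟩
  | Sig_eta _ ih₁ => exact ⟨ih₁.1, fun Δ σ τ hΔ hσ => hΔ⟩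
  | Id_ty _ _ _ ih₁ ih₂ ih₃ =>
    exact ⟨ih₁.1, fun Δ σ τ hΔ hσ => Der.Id_eqTy (ih₁.2 hΔ hσ) (ih₂.2 hΔ hσ) (ih₃.2 hΔ hσ)⟩
  | Id_eqTy _ _ _ ih₁ ih₂ ih₃ => exact ⟨ih₁.1, fun Δ σ τ hΔ hσ => hΔ⟩
  | Id_U _ _ _ ih₁ ih₂ ih₃ =>
    exact ⟨ih₁.1, fun Δ σ τ hΔ hσ => Der.Id_eqU (ih₁.2 hΔ hσ) (ih₂.2 hΔ hσ) (ih₃.2 hΔ hσ)⟩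
  | Id_eqU _ _ _ ih₁ ih₂ ih₃ => exact ⟨ih₁.1, fun Δ σ τ hΔ hσ => hΔ⟩
  | refl _ ih₁ =>
    exact ⟨ih₁.1, fun Δ σ τ hΔ hσ => Der.refl_eq (ih₁.2 hΔ hσ)⟩
  | refl_eq _ ih₁ => exact ⟨ih₁.1, fun Δ σ τ hΔ hσ => hΔ⟩
  | J h₁ _ _ h₄ _ ih₁ ih₂ ih₃ _ ih₅ =>
    exact ⟨ih₁.1, fun Δ σ τ hΔ hσ => by
      simpa using Der.J_eq (h₁.subst hΔ hσ.left) (by simpa using ih₂.under₂ hΔ hσ) (by simpa using ih₃.2 hΔ hσ) (h₄.subst hΔ hσ.left) (ih₅.2 hΔ hσ)⟩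
  | J_eq _ _ _ _ _ ih₁ ih₂ ih₃ ih₄ ih₅ => exact ⟨ih₁.1, fun Δ σ τ hΔ hσ => hΔ⟩
  | J_beta _ _ _ ih₁ ih₂ ih₃ => exact ⟨ih₁.1, fun Δ σ τ hΔ hσ => hΔ⟩
  | Sum_ty _ _ ih₁ ih₂ =>
    exact ⟨ih₁.1, fun Δ σ τ hΔ hσ => Der.Sum_eqTy (ih₁.2 hΔ hσ) (ih₂.2 hΔ hσ)⟩
  | Sum_eqTy _ _ ih₁ ih₂ => exact ⟨ih₁.1, fun Δ σ τ hΔ hσ => hΔ⟩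
  | Sum_U _ _ ih₁ ih₂ =>
    exact ⟨ih₁.1, fun Δ σ τ hΔ hσ => Der.Sum_eqU (ih₁.2 hΔ hσ) (ih₂.2 hΔ hσ)⟩
  | Sum_eqU _ _ ih₁ ih₂ => exact ⟨ih₁.1, fun Δ σ τ hΔ hσ => hΔ⟩
  | inl h₁ _ ih₁ ih₂ =>
    exact ⟨ih₁.1, fun Δ σ τ hΔ hσ => Der.inl_eq (h₁.subst hΔ hσ.left) (ih₂.2 hΔ hσ)⟩
  | inl_eq _ _ ih₁ ih₂ => exact ⟨ih₁.1, fun Δ σ τ hΔ hσ => hΔ⟩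
  | inr h₁ _ ih₁ ih₂ =>
    exact ⟨ih₁.1, fun Δ σ τ hΔ hσ => Der.inr_eq (h₁.subst hΔ hσ.left) (ih₂.2 hΔ hσ)⟩
  | inr_eq _ _ ih₁ ih₂ => exact ⟨ih₁.1, fun Δ σ τ hΔ hσ => hΔ⟩
  | case _ _ _ _ ih₁ ih₂ ih₃ ih₄ =>
    exact ⟨ih₄.1, fun Δ σ τ hΔ hσ => by
      simpa using Der.case_eq (ih₁.under hΔ hσ) (by simpa using ih₂.under hΔ hσ) (by simpa using ih₃.under hΔ hσ) (ih₄.2 hΔ hσ)⟩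
  | case_eq _ _ _ _ ih₁ ih₂ ih₃ ih₄ => exact ⟨ih₄.1, fun Δ σ τ hΔ hσ => hΔ⟩
  | inl_beta _ _ _ _ ih₁ ih₂ ih₃ ih₄ => exact ⟨ih₄.1, fun Δ σ τ hΔ hσ => hΔ⟩
  | inr_beta _ _ _ _ ih₁ ih₂ ih₃ ih₄ => exact ⟨ih₄.1, fun Δ σ τ hΔ hσ => hΔ⟩
  | Empty_ty _ ih₁ => exact ⟨ih₁.1, fun Δ σ τ hΔ hσ => .ty_rfl (.Empty_ty hΔ)⟩
  | Empty_U _ ih₁ => exact ⟨ih₁.1, fun Δ σ τ hΔ hσ => .tm_rfl (.Empty_U hΔ)⟩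
  | absurd _ _ ih₁ ih₂ =>
    exact ⟨ih₂.1, fun Δ σ τ hΔ hσ => by
      simpa using Der.absurd_eq (ih₁.under hΔ hσ) (ih₂.2 hΔ hσ)⟩
  | absurd_eq _ _ ih₁ ih₂ => exact ⟨ih₂.1, fun Δ σ τ hΔ hσ => hΔ⟩
  | Unit_ty _ ih₁ => exact ⟨ih₁.1, fun Δ σ τ hΔ hσ => .ty_rfl (.Unit_ty hΔ)⟩
  | Unit_U _ ih₁ => exact ⟨ih₁.1, fun Δ σ τ hΔ hσ => .tm_rfl (.Unit_U hΔ)⟩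
  | star _ ih₁ => exact ⟨ih₁.1, fun Δ σ τ hΔ hσ => .tm_rfl (.star hΔ)⟩
  | Unit_eta _ ih₁ => exact ⟨ih₁.1, fun Δ σ τ hΔ hσ => hΔ⟩

/-! ## Inversion of type formers -/

/-- The components of a type are well formed. -/
def Formed (Γ : Ctx) : Tm → Prop
  | Pi A B => Der Γ (ty A) ∧ Der (A :: Γ) (ty B)
  | Sig A B => Der Γ (ty A) ∧ Der (A :: Γ) (ty B)
  | Tm.Id A a b => Der Γ (ty A) ∧ Der Γ (tm a A) ∧ Der Γ (tm b A)
  | _ => True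

def Judgment.Formed (Γ : Ctx) : Judgment → Prop
  | ty A => ITT.Formed Γ A
  | tm A _ => ITT.Formed Γ A
  | _ => True

/-- Conversion changes the type of a term but never the term, so the last rule other than `conv` and
`el` is the formation rule and shows the components. Including typing judgments covers types that
arise as elements of `U`. -/
theorem Der.formed {Γ 𝒥} (h : Der Γ 𝒥) : 𝒥.Formed Γ := by
  induction h with
  | Pi_ty h₁ h₂ => exact ⟨h₁, h₂⟩
  | Pi_U h₁ h₂ => exact ⟨h₁.el, h₂.el⟩
  | Sig_ty h₁ h₂ => exact ⟨h₁, h₂⟩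
  | Sig_U h₁ h₂ => exact ⟨h₁.el, h₂.el⟩
  | Id_ty h₁ h₂ h₃ => exact ⟨h₁, h₂, h₃⟩
  | Id_U h₁ h₂ h₃ => exact ⟨h₁.el, h₂, h₃⟩
  | el _ ih => exact ih
  | conv _ _ ih => exact ih
  | _ => trivial

theorem Der.Pi_inv {Γ A B} (h : Der Γ (ty (Pi A B))) : Der Γ (ty A) ∧ Der (A :: Γ) (ty B) :=
  h.formed

theorem Der.Sig_inv {Γ A B} (h : Der Γ (ty (Sig A B))) : Der Γ (ty A) ∧ Der (A :: Γ) (ty B) :=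
  h.formed

theorem Der.Id_inv {Γ A a b} (h : Der Γ (ty (.Id A a b))) :
    Der Γ (ty A) ∧ Der Γ (tm a A) ∧ Der Γ (tm b A) :=
  h.formed

/-! ## Instantiation -/

theorem Sub.inst {Γ a A} (ha : Der Γ (tm a A)) : Sub (A :: Γ) Γ (Tm.scons a .var) :=
  (Sub.id ha.ctx).scons (by simpa using ha)

theorem Sub.inst₂ {Γ a A p P} (ha : Der Γ (tm a A)) (hp : Der Γ (tm p (P.inst a))) :
    Sub (P :: A :: Γ) Γ (Tm.scons p (Tm.scons a .var)) :=
  (Sub.inst ha).scons (by simpa [inst_eq] using hp)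

theorem Sub.wk {Γ A} (hA : Der Γ (ty A)) : Sub Γ (A :: Γ) fun n => .var (n + 1) := fun n B hn => by
  simpa [wk_eq] using Der.var (.cons hA.ctx hA) (hn.there A)

theorem Sub.replace {Γ A B u} (hu : Der (B :: Γ) (tm u A.wk)) :
    Sub (A :: Γ) (B :: Γ) (Tm.scons u fun n => .var (n + 1)) :=
  (Sub.wk hu.ctx.head).scons (by simpa [wk_eq] using hu)

theorem SubEq.scons {Γ Δ σ τ a a' A} (h : SubEq Γ Δ σ τ) (ha : Der Δ (tm a (A.subst σ)))
    (ha' : Der Δ (tm a' (A.subst τ))) (e : Der Δ (eqTm a a' (A.subst σ))) :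
    SubEq (A :: Γ) Δ (Tm.scons a σ) (Tm.scons a' τ) where
  left := h.left.scons ha
  right := h.right.scons ha'
  eq n B hn := by
    cases hn with
    | here => simpa using e
    | there _ hn => simpa using h.eq hn

theorem SubEq.id {Γ} (h : Der Γ .ctx) : SubEq Γ Γ .var .var :=
  ⟨Sub.id h, Sub.id h, fun n A hn => by simpa using (Der.var h hn).tm_rfl⟩

theorem SubEq.inst {Γ a a' A} (ha : Der Γ (tm a A)) (ha' : Der Γ (tm a' A))
    (e : Der Γ (eqTm a a' A)) : SubEq (A :: Γ) Γ (Tm.scons a .var) (Tm.scons a' .var) :=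
  (SubEq.id ha.ctx).scons (by simpa using ha) (by simpa using ha') (by simpa using e)

namespace Der

theorem inst_ty {Γ A B a} (h : Der (A :: Γ) (ty B)) (ha : Der Γ (tm a A)) :
    Der Γ (ty (B.inst a)) := by
  simpa [inst_eq] using h.subst ha.ctx (Sub.inst ha)

theorem inst_eqTy {Γ A B B' a} (h : Der (A :: Γ) (eqTy B B')) (ha : Der Γ (tm a A)) :
    Der Γ (eqTy (B.inst a) (B'.inst a)) := by
  simpa [inst_eq] using h.subst ha.ctx (Sub.inst ha)

theorem inst_tm {Γ A b B a} (h : Der (A :: Γ) (tm b B)) (ha : Der Γ (tm a A)) :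
    Der Γ (tm (b.inst a) (B.inst a)) := by
  simpa [inst_eq] using h.subst ha.ctx (Sub.inst ha)

theorem inst_congr {Γ A B a a'} (h : Der (A :: Γ) (ty B)) (ha : Der Γ (tm a A))
    (ha' : Der Γ (tm a' A)) (e : Der Γ (eqTm a a' A)) : Der Γ (eqTy (B.inst a) (B.inst a')) := by
  simpa [inst_eq] using h.functional.2 ha.ctx (SubEq.inst ha ha' e)

section PathInduction

variable {Γ : Ctx} {A a b C p : Tm}

theorem inst_Id (A a b : Tm) : (Tm.Id A.wk a.wk (.var 0)).inst b = .Id A a b := by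
  simp [inst_eq]

theorem inst₂_ty (h : Der (.Id A.wk a.wk (.var 0) :: A :: Γ) (ty C)) (hb : Der Γ (tm b A))
    (hp : Der Γ (tm p (.Id A a b))) : Der Γ (ty (C.inst₂ b p)) := by
  simpa [inst₂_eq] using h.subst hb.ctx (Sub.inst₂ hb (by rwa [inst_Id]))

theorem inst₂_eqTy {C'} (h : Der (.Id A.wk a.wk (.var 0) :: A :: Γ) (eqTy C C'))
    (hb : Der Γ (tm b A)) (hp : Der Γ (tm p (.Id A a b))) :
    Der Γ (eqTy (C.inst₂ b p) (C'.inst₂ b p)) := by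
  simpa [inst₂_eq] using h.subst hb.ctx (Sub.inst₂ hb (by rwa [inst_Id]))

theorem inst₂_congr {p'} (h : Der (.Id A.wk a.wk (.var 0) :: A :: Γ) (ty C))
    (hb : Der Γ (tm b A)) (hp : Der Γ (tm p (.Id A a b))) (hp' : Der Γ (tm p' (.Id A a b)))
    (e : Der Γ (eqTm p p' (.Id A a b))) : Der Γ (eqTy (C.inst₂ b p) (C.inst₂ b p')) := by
  have := h.functional.2 hb.ctx ((SubEq.inst hb hb hb.tm_rfl).scons (a := p) (a' := p')
    (by simpa using hp) (by simpa using hp') (by simpa using e))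
  simpa [inst₂_eq] using this

end PathInduction

theorem replace_eqTy {Γ A B C C' u} (h : Der (A :: Γ) (eqTy C C'))
    (hu : Der (B :: Γ) (tm u A.wk)) : Der (B :: Γ) (eqTy (C.replace u) (C'.replace u)) := by
  simpa [replace_eq] using h.subst hu.ctx (Sub.replace hu)

/-- The last type of a context may be replaced by a strictly equal one. -/
theorem ctx_conv {Γ A A' 𝒥} (h : Der (A :: Γ) 𝒥) (hA' : Der Γ (ty A'))
    (e : Der Γ (eqTy A A')) : Der (A' :: Γ) 𝒥 := by
  have hΔ : Der (A' :: Γ) .ctx := .cons hA'.ctx hA'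
  have := h.subst hΔ (σ := .var) fun n B hn => by
    cases hn with
    | here => simpa using hA'.var_zero.conv (e.ty_symm.wk_eqTy hA')
    | there _ hn => simpa using Der.var hΔ (hn.there A')
  cases 𝒥 <;> simpa using this

theorem lookup_ty {Γ n A} (h : Der Γ .ctx) (hn : Lookup Γ n A) : Der Γ (ty A) := by
  induction hn with
  | here => exact h.head.wk_ty h.head
  | there _ _ ih => exact (ih h.tail).wk_ty h.head

/-! ## Regularity -/

theorem inl_var {Γ A B} (hA : Der Γ (ty A)) (hB : Der Γ (ty B)) :
    Der (A :: Γ) (tm (.inl (.var 0)) (Sum A B).wk) :=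
  inl (hB.wk_ty hA) hA.var_zero

theorem inr_var {Γ A B} (hA : Der Γ (ty A)) (hB : Der Γ (ty B)) :
    Der (B :: Γ) (tm (.inr (.var 0)) (Sum A B).wk) :=
  inr (hA.wk_ty hB) hB.var_zero

theorem lam_app_var {Γ A B f} (hf : Der Γ (tm f (Pi A B))) (hA : Der Γ (ty A)) :
    Der (A :: Γ) (tm (.app f.wk (.var 0)) B) := by
  have h : Der (A :: Γ) (tm f.wk (Pi A B).wk) := hf.wk_tm hA
  simp only [wk_eq, Tm.subst] at h
  have := h.app (a := .var 0) (by simpa [wk_eq] using hA.var_zero)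
  rw [subst_liftSub_inst] at this
  have e : Tm.scons (.var 0) (fun n => .var (n + 1)) = Tm.var := by funext n; cases n <;> rfl
  simpa [e, wk_eq] using this

end Der

/-- The presuppositions of a judgment. -/
def Judgment.Regular (Γ : Ctx) : Judgment → Prop
  | tm _ A => Der Γ (ty A)
  | eqTy A B => Der Γ (ty A) ∧ Der Γ (ty B)
  | eqTm a b A => Der Γ (tm a A) ∧ Der Γ (tm b A) ∧ Der Γ (ty A)
  | _ => True

theorem replace_inst (C u a : Tm) : (C.replace u).inst a = C.inst (u.inst a) := by
  rw [replace_eq, inst_eq, inst_eq, inst_eq, subst_subst]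
  congr 1; funext n; cases n <;> rfl

/-- In a congruence rule the right-hand side is naturally typed over its own domain and at its own
instance. `ctx_conv` and the `inst_congr` lemmas bring it back to the stated type. -/
theorem Der.regular {Γ 𝒥} (h : Der Γ 𝒥) : 𝒥.Regular Γ := by
  induction h with
  | nil | cons | U_ty | el | Pi_ty | Sig_ty | Id_ty | Sum_ty | Empty_ty | Unit_ty => trivial
  | var h hn => exact h.lookup_ty hn
  | ty_rfl h => exact ⟨h, h⟩
  | ty_symm _ ih => exact ⟨ih.2, ih.1⟩
  | ty_trans _ _ ih₁ ih₂ => exact ⟨ih₁.1, ih₂.2⟩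
  | tm_rfl h ih => exact ⟨h, h, ih⟩
  | tm_symm _ ih => exact ⟨ih.2.1, ih.1, ih.2.2⟩
  | tm_trans _ _ ih₁ ih₂ => exact ⟨ih₁.1, ih₂.2.1, ih₁.2.2⟩
  | conv _ _ _ ih => exact ih.2
  | conv_eq _ h ih₁ ih₂ => exact ⟨ih₁.1.conv h, ih₁.2.1.conv h, ih₂.2⟩
  | el_eq _ ih => exact ⟨ih.1.el, ih.2.1.el⟩
  | Pi_eqTy hA e _ _ ih₁ ih₂ => exact ⟨.Pi_ty hA ih₂.1, .Pi_ty ih₁.2 (ih₂.2.ctx_conv ih₁.2 e)⟩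
  | Pi_U h => exact .U_ty h.ctx
  | Pi_eqU hA e _ ih₀ ih₁ ih₂ =>
    exact ⟨.Pi_U hA ih₂.1, .Pi_U ih₁.2.1 (ih₂.2.1.ctx_conv ih₁.2.1.el e.el_eq), ih₀⟩
  | lam hA _ _ ih => exact .Pi_ty hA ih
  | lam_eq hA e _ _ ih₁ ih₂ =>
    exact ⟨.lam hA ih₂.1, (Der.lam ih₁.2 (ih₂.2.1.ctx_conv ih₁.2 e)).conv
      (Der.Pi_eqTy hA e ih₂.2.2.ty_rfl).ty_symm, .Pi_ty hA ih₂.2.2⟩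
  | app _ ha ih => exact ih.Pi_inv.2.inst_ty ha
  | app_eq _ e ih₁ ih₂ =>
    have hB := ih₁.2.2.Pi_inv.2
    exact ⟨ih₁.1.app ih₂.1,
      (ih₁.2.1.app ih₂.2.1).conv (hB.inst_congr ih₂.1 ih₂.2.1 e).ty_symm, hB.inst_ty ih₂.1⟩
  | Pi_beta hA hb ha _ ih => exact ⟨(Der.lam hA hb).app ha, hb.inst_tm ha, ih.inst_ty ha⟩
  | Pi_eta hf ih => exact ⟨.lam ih.Pi_inv.1 (hf.lam_app_var ih.Pi_inv.1), hf, ih⟩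
  | Sig_eqTy hA e _ _ ih₁ ih₂ => exact ⟨.Sig_ty hA ih₂.1, .Sig_ty ih₁.2 (ih₂.2.ctx_conv ih₁.2 e)⟩
  | Sig_U h => exact .U_ty h.ctx
  | Sig_eqU hA e _ ih₀ ih₁ ih₂ =>
    exact ⟨.Sig_U hA ih₂.1, .Sig_U ih₁.2.1 (ih₂.2.1.ctx_conv ih₁.2.1.el e.el_eq), ih₀⟩
  | pair hB _ _ _ ih => exact .Sig_ty ih hB
  | pair_eq hB e _ _ ih₁ ih₂ =>
    exact ⟨.pair hB ih₁.1 ih₂.1,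
      .pair hB ih₁.2.1 (ih₂.2.1.conv (hB.inst_congr ih₁.1 ih₁.2.1 e)), .Sig_ty ih₁.2.2 hB⟩
  | fst _ ih => exact ih.Sig_inv.1
  | fst_eq _ ih => exact ⟨ih.1.fst, ih.2.1.fst, ih.2.2.Sig_inv.1⟩
  | snd h ih => exact ih.Sig_inv.2.inst_ty h.fst
  | snd_eq e ih =>
    have hB := ih.2.2.Sig_inv.2
    exact ⟨ih.1.snd, ih.2.1.snd.conv (hB.inst_congr ih.1.fst ih.2.1.fst e.fst_eq).ty_symm,
      hB.inst_ty ih.1.fst⟩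
  | fst_beta hB ha hb _ ih => exact ⟨(Der.pair hB ha hb).fst, ha, ih⟩
  | snd_beta hB ha hb _ ih ih' =>
    have h := Der.pair hB ha hb
    exact ⟨h.snd.conv (hB.inst_congr h.fst ha (.fst_beta hB ha hb)), hb, ih'⟩
  | Sig_eta h ih => exact ⟨.pair ih.Sig_inv.2 h.fst h.snd, h, ih⟩
  | Id_eqTy e _ _ ih ih₁ ih₂ =>
    exact ⟨.Id_ty ih.1 ih₁.1 ih₂.1, .Id_ty ih.2 (ih₁.2.1.conv e) (ih₂.2.1.conv e)⟩
  | Id_U h => exact .U_ty h.ctx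
  | Id_eqU e _ _ ih ih₁ ih₂ =>
    exact ⟨.Id_U ih.1 ih₁.1 ih₂.1, .Id_U ih.2.1 (ih₁.2.1.conv e.el_eq) (ih₂.2.1.conv e.el_eq),
      ih.2.2⟩
  | refl h ih => exact .Id_ty ih h h
  | refl_eq e ih =>
    exact ⟨.refl ih.1, (Der.refl ih.2.1).conv (.Id_eqTy ih.2.2.ty_rfl e.tm_symm e.tm_symm),
      .Id_ty ih.2.2 ih.1 ih.1⟩
  | J _ hC _ hb hp => exact hC.inst₂_ty hb hp
  | J_eq ha e _ hb ep _ ih₁ ih₂ _ ih₃ =>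
    refine ⟨.J ha ih₁.1 ih₂.1 hb ih₃.1, (Der.J ha ih₁.2 (ih₂.2.1.conv (e.inst₂_eqTy ha (.refl ha)))
      hb ih₃.2.1).conv ?_, ih₁.1.inst₂_ty hb ih₃.1⟩
    exact ((ih₁.1.inst₂_congr hb ih₃.1 ih₃.2.1 ep).ty_trans (e.inst₂_eqTy hb ih₃.2.1)).ty_symm
  | J_beta ha hC hd _ _ ih => exact ⟨.J ha hC hd ha (.refl ha), hd, ih⟩
  | Sum_eqTy _ _ ih₁ ih₂ => exact ⟨.Sum_ty ih₁.1 ih₂.1, .Sum_ty ih₁.2 ih₂.2⟩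
  | Sum_U h => exact .U_ty h.ctx
  | Sum_eqU _ _ ih₁ ih₂ => exact ⟨.Sum_U ih₁.1 ih₂.1, .Sum_U ih₁.2.1 ih₂.2.1, ih₁.2.2⟩
  | inl h _ _ ih => exact .Sum_ty ih h
  | inl_eq h _ _ ih => exact ⟨.inl h ih.1, .inl h ih.2.1, .Sum_ty ih.2.2 h⟩
  | inr h _ _ ih => exact .Sum_ty h ih
  | inr_eq h _ _ ih => exact ⟨.inr h ih.1, .inr h ih.2.1, .Sum_ty h ih.2.2⟩
  | case hC _ _ hs => exact hC.inst_ty hs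
  | case_eq e hl hr es ih ih₁ ih₂ ih₃ =>
    have hA := hl.ctx.head
    have hB := hr.ctx.head
    refine ⟨.case ih.1 ih₁.1 ih₂.1 ih₃.1, (Der.case ih.2
      (ih₁.2.1.conv (e.replace_eqTy (hA.inl_var hB)))
      (ih₂.2.1.conv (e.replace_eqTy (hA.inr_var hB))) ih₃.2.1).conv ?_, ih.1.inst_ty ih₃.1⟩
    exact ((ih.1.inst_congr ih₃.1 ih₃.2.1 es).ty_trans (e.inst_eqTy ih₃.2.1)).ty_symm
  | @inl_beta _ _ _ C _ _ a hC hl hr ha =>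
    have h := Der.inl hr.ctx.head ha
    exact ⟨.case hC hl hr h, replace_inst C (.inl (.var 0)) a ▸ hl.inst_tm ha, hC.inst_ty h⟩
  | @inr_beta _ _ _ C _ _ b hC hl hr hb =>
    have h := Der.inr hl.ctx.head hb
    exact ⟨.case hC hl hr h, replace_inst C (.inr (.var 0)) b ▸ hr.inst_tm hb, hC.inst_ty h⟩
  | Empty_U h | Unit_U h => exact .U_ty h
  | absurd hC he => exact hC.inst_ty he
  | absurd_eq e ee ih₁ ih₂ =>
    exact ⟨.absurd ih₁.1 ih₂.1, (Der.absurd ih₁.2 ih₂.2.1).conv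
      ((ih₁.1.inst_congr ih₂.1 ih₂.2.1 ee).ty_trans (e.inst_eqTy ih₂.2.1)).ty_symm,
      ih₁.1.inst_ty ih₂.1⟩
  | star h => exact .Unit_ty h
  | Unit_eta h ih => exact ⟨h, .star h.ctx, ih⟩

/-! ## A normalizing type checker -/

namespace Tm

/-- Boolean equality of raw expressions built from the type formers that the checker supports. -/
def beq : Tm → Tm → Bool
  | var m, var n => Nat.beq m n
  | U, U => true
  | Pi A B, Pi A' B' => beq A A' && beq B B'
  | lam A B, lam A' B' => beq A A' && beq B B'
  | app A B, app A' B' => beq A A' && beq B B'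
  | Sig A B, Sig A' B' => beq A A' && beq B B'
  | pair A B, pair A' B' => beq A A' && beq B B'
  | fst p, fst p' => beq p p'
  | snd p, snd p' => beq p p'
  | Id A a b, Id A' a' b' => beq A A' && beq a a' && beq b b'
  | refl a, refl a' => beq a a'
  | J C d p, J C' d' p' => beq C C' && beq d d' && beq p p'
  | _, _ => false

end Tm

namespace Tm

/-- Not an introduction form of `Π`, `Σ` or identity types. -/
def neutral : Tm → Bool
  | lam _ _ => false
  | pair _ _ => false
  | refl _ => false
  | _ => true

/-- Free of `β` redexes and of candidates for `η` redexes. -/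
def normal : Tm → Bool
  | var _ => true
  | U => true
  | Pi A B => normal A && normal B
  | lam _ (app _ (var 0)) => false
  | lam A b => normal A && normal b
  | app (lam _ _) _ => false
  | app f a => normal f && normal a
  | Sig A B => normal A && normal B
  | pair (fst _) (snd _) => false
  | pair a b => normal a && normal b
  | fst (pair _ _) => false
  | fst p => normal p
  | snd (pair _ _) => false
  | snd p => normal p
  | Id A a b => normal A && normal a && normal b
  | refl a => normal a
  | J _ _ (refl _) => false
  | J C d p => normal C && normal d && normal p
  | _ => false

end Tm

/-- A normal form together with its type. -/
abbrev Value : Type := Tm × Tm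

/-- Environments: a value and its type for each variable; `wk ρ` is `ρ` weakened by one variable. -/
inductive Env : Type
  | nil
  | cons (v A : Tm) (ρ : Env)
  | wk (ρ : Env)

namespace Env

/-- The value of a variable, weakened by `k` variables. -/
def get? : Env → ℕ → ℕ → Option Value
  | nil, _, _ => none
  | cons v A _, 0, k => some (v.rename (· + k), A.rename (· + k))
  | cons _ _ ρ, n + 1, k => get? ρ n k
  | wk ρ, n, k => get? ρ n (k + 1)

/-- Extend an environment under a binder. -/
def lift (ρ : Env) (A : Tm) : Env := cons (var 0) A.wk ρ.wk

/-- The identity environment of a context. -/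
def ofCtx : Ctx → Env
  | [] => nil
  | A :: Γ => (ofCtx Γ).lift A

end Env

/-- The three functions of a bidirectional type checker. Their arguments are a context `Γ`, an
environment over `Γ`, and an expression over the variables of the environment; they return normal
forms over `Γ`. -/
structure Checker where
  type : Ctx → Env → Tm → Option Tm
  infer : Ctx → Env → Tm → Option Value
  check : Ctx → Env → Tm → Tm → Option Tm

namespace Checker

/-- Whether the introduction form `t : T` shows its premises. -/
def certify (r : Checker) (Γ : Ctx) (t T : Tm) : Bool :=
  t.neutral || match r.check Γ (Env.ofCtx Γ) t T with
    | some t' => beq t' t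
    | none => false

/-- The normal form of the type `B.inst a`, for `a : A`. -/
def inst (r : Checker) (Γ : Ctx) (B a A : Tm) : Option Tm :=
  bif (B.inst a).normal then some (B.inst a)
  else bif r.certify Γ a A then r.type Γ (.cons a A (Env.ofCtx Γ)) B else none

/-- The normal form of the type `C.inst₂ a p`, for `a : A` and `p : P`. -/
def inst₂ (r : Checker) (Γ : Ctx) (C a A p P : Tm) : Option Tm :=
  bif (C.inst₂ a p).normal then some (C.inst₂ a p)
  else bif r.certify Γ a A && r.certify Γ p P then
    r.type Γ (.cons p P (.cons a A (Env.ofCtx Γ))) C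
  else none

/-- The normal form of `b.inst a : T`, for `a : A`. -/
def instTm (r : Checker) (Γ : Ctx) (b a A T : Tm) : Option Tm :=
  bif (b.inst a).neutral && (b.inst a).normal then some (b.inst a)
  else bif r.certify Γ a A then r.check Γ (.cons a A (Env.ofCtx Γ)) b T else none

/-- The normal form of `t : T`. -/
def recheck (r : Checker) (Γ : Ctx) (t T : Tm) : Option Tm :=
  bif t.neutral && t.normal then some t else r.check Γ (Env.ofCtx Γ) t T

/-- The `η` normal form of `lam A b`. -/
def etaLam (r : Checker) (Γ : Ctx) (A B b : Tm) : Option Tm :=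
  match b with
  | app g (var 0) =>
    -- Lowering every index undoes a weakening; the comparison with `f.wk` tests that variable 0
    -- does not occur in `g`.
    let f := g.rename Nat.pred
    bif beq f.wk g then
      -- The type of `f` is recomputed because the typing of the application is not inverted.
      match r.infer Γ (Env.ofCtx Γ) f with
      | some (f', T) => bif beq T (Pi A B) then some f' else none
      | none => none
    else some (lam A b)
  | _ => some (lam A b)

/-- The `η` normal form of `pair a b`. -/
def etaPair (r : Checker) (Γ : Ctx) (A B a b : Tm) : Option Tm :=
  match a, b with
  | fst p, snd q =>
    bif beq p q then
      match r.infer Γ (Env.ofCtx Γ) p with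
      -- A mismatch is not an error: the same pair may also be typed by another `Σ` type, such as
      -- the nondependent one that inference assigns.
      | some (p', T) => bif beq T (Sig A B) then some p' else some (pair a b)
      | none => none
    else some (pair a b)
  | _, _ => some (pair a b)

def typeStep (r : Checker) (Γ : Ctx) (ρ : Env) : Tm → Option Tm
  | U => some U
  | Pi A B => do
    let A' ← r.type Γ ρ A
    let B' ← r.type (A' :: Γ) (ρ.lift A') B
    some (Pi A' B')
  | Sig A B => do
    let A' ← r.type Γ ρ A
    let B' ← r.type (A' :: Γ) (ρ.lift A') B
    some (Sig A' B')
  | Tm.Id A a b => do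
    let A' ← r.type Γ ρ A
    let a' ← r.check Γ ρ a A'
    let b' ← r.check Γ ρ b A'
    some (Id A' a' b')
  | A =>
    match r.infer Γ ρ A with
    | some (A', U) => some A'
    | _ => none

/-- Computation happens in the eliminators: once the principal argument has been evaluated, a `λ`,
pair or `refl` in its place triggers the `β` rule. A bare pair receives a nondependent `Σ` type. -/
def inferStep (r : Checker) (Γ : Ctx) (ρ : Env) : Tm → Option Value
  | var n => ρ.get? n 0
  | Pi A B => do
    let A' ← r.check Γ ρ A U
    let B' ← r.check (A' :: Γ) (ρ.lift A') B U
    some (Pi A' B', U)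
  | Sig A B => do
    let A' ← r.check Γ ρ A U
    let B' ← r.check (A' :: Γ) (ρ.lift A') B U
    some (Sig A' B', U)
  | Tm.Id A a b => do
    let A' ← r.check Γ ρ A U
    let a' ← r.check Γ ρ a A'
    let b' ← r.check Γ ρ b A'
    some (Id A' a' b', U)
  | lam A b => do
    let A' ← r.type Γ ρ A
    let (b', B) ← r.infer (A' :: Γ) (ρ.lift A') b
    let t ← etaLam r Γ A' B b'
    some (t, Pi A' B)
  | app f a => do
    match ← r.infer Γ ρ f with
    | (f', Pi A B) =>
      let a' ← r.check Γ ρ a A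
      let R ← r.inst Γ B a' A
      match f' with
      | lam _ b =>
        let t ← r.instTm Γ b a' A R
        some (t, R)
      | f' => some (app f' a', R)
    | _ => none
  | pair a b => do
    let (a', A) ← r.infer Γ ρ a
    let (b', B) ← r.infer Γ ρ b
    let t ← etaPair r Γ A B.wk a' b'
    some (t, Sig A B.wk)
  | fst p => do
    match ← r.infer Γ ρ p with
    | (p', Sig A _) =>
      match p' with
      | pair a _ =>
        let t ← r.recheck Γ a A
        some (t, A)
      | p' => some (fst p', A)
    | _ => none
  | snd p => do
    match ← r.infer Γ ρ p with
    | (p', Sig A B) =>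
      match p' with
      | pair a b =>
        let R ← r.inst Γ B a A
        let t ← r.recheck Γ b R
        some (t, R)
      | p' =>
        let R ← r.inst Γ B (fst p') A
        some (snd p', R)
    | _ => none
  | Tm.refl a => do
    let (a', A) ← r.infer Γ ρ a
    some (refl a', Id A a' a')
  | J C d p => do
    match ← r.infer Γ ρ p with
    | (p', Tm.Id A a b) =>
      let P := Id A.wk a.wk (var 0)
      let C' ← r.type (P :: A :: Γ) ((ρ.lift A).lift P) C
      let D ← r.inst₂ Γ C' a A (refl a) (Id A a a)
      let d' ← r.check Γ ρ d D
      match p' with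
      | Tm.refl _ => some (d', D)
      | p' =>
        let R ← r.inst₂ Γ C' b A p' (Id A a b)
        some (J C' d' p', R)
    | _ => none
  | _ => none

/-- Pairs carry no family annotation, so a dependent pair is typed from its expected type.
Conversion occurs only in the last clause, as syntactic equality of computed types. -/
def checkStep (r : Checker) (Γ : Ctx) (ρ : Env) (t T : Tm) : Option Tm :=
  match t, T with
  | lam A b, Pi A₀ B => do
    let A' ← r.type Γ ρ A
    bif beq A' A₀ then (r.check (A₀ :: Γ) (ρ.lift A₀) b B).bind (etaLam r Γ A₀ B) else none
  | pair a b, Sig A B => do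
    let a' ← r.check Γ ρ a A
    let R ← r.inst Γ B a' A
    let b' ← r.check Γ ρ b R
    etaPair r Γ A B a' b'
  | Tm.refl a, Tm.Id A b c => do
    let a' ← r.check Γ ρ a A
    bif beq a' b && beq a' c then some (refl a') else none
  | t, T => do
    let (t', T') ← r.infer Γ ρ t
    bif beq T' T then some t' else none

def step (r : Checker) : Checker := ⟨typeStep r, inferStep r, checkStep r⟩

/-- The checker with recursion depth bounded by the argument. -/
def run : ℕ → Checker :=
  Nat.rec ⟨fun _ _ _ => none, fun _ _ _ => none, fun _ _ _ _ => none⟩ fun _ r => step r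

end Checker

/-- Whether the checker, with bounded recursion depth, accepts the closed term `t : A`. -/
def derives (n : ℕ) (t A : Tm) : Bool :=
  match (Checker.run n).type [] .nil A with
  | some A' => ((Checker.run n).check [] .nil t A').isSome
  | none => false

/-! ## Soundness of the checker -/

theorem Tm.eq_of_beq {t u : Tm} (h : beq t u = true) : t = u := by
  fun_induction beq t u <;> simp_all

@[simp] theorem Tm.rename_id (t : Tm) : t.rename (fun n => n) = t := by
  simp [rename_eq_subst]

theorem Tm.rename_wk (t : Tm) (k : ℕ) : t.wk.rename (· + k) = t.rename (· + (k + 1)) := by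
  rw [rename_eq_subst, wk_subst, rename_eq_subst]; congr 1; funext n; congr 1; omega

theorem Tm.liftSub_eq_scons (σ : ℕ → Tm) : liftSub σ = scons (.var 0) fun n => (σ n).wk := by
  funext n; cases n <;> rfl

/-- An introduction form shows its premises. -/
def Canonical (Γ : Ctx) : Tm → Tm → Prop
  | lam A b, T => ∃ B, T = Pi A B ∧ Der (A :: Γ) (tm b B)
  | pair a b, T => ∃ A B, T = Sig A B ∧ Der Γ (tm a A) ∧ Der Γ (tm b (B.inst a))
  | Tm.refl a, T => ∃ A, T = Id A a a
  | _, _ => True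

theorem Canonical.of_neutral {Γ t T} (h : t.neutral = true) : Canonical Γ t T := by
  cases t <;> trivial

/-- Typed, with evidence for introduction forms. -/
structure Good (Γ : Ctx) (t T : Tm) : Prop where
  typed : Der Γ (tm t T)
  canonical : Canonical Γ t T

theorem Good.wk {Γ t T A} (h : Good Γ t T) (hA : Der Γ (ty A)) : Good (A :: Γ) t.wk T.wk := by
  refine ⟨h.typed.wk_tm hA, ?_⟩
  have hw := Sub.wk hA
  have hc : Der (A :: Γ) ctx := .cons hA.ctx hA
  have h := h.canonical
  cases t with
  | lam C b =>
    obtain ⟨B, rfl, hb⟩ := h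
    exact ⟨_, rfl, by simpa [wk_eq, rename_eq_subst, liftSub_ren] using hb.subst_under hc hw⟩
  | pair a b =>
    obtain ⟨C, B, rfl, ha, hb⟩ := h
    refine ⟨_, _, rfl, ha.wk_tm hA, ?_⟩
    simpa [wk_eq, rename_eq_subst, liftSub_ren] using hb.subst hc hw
  | refl a =>
    obtain ⟨B, rfl⟩ := h
    exact ⟨_, rfl⟩
  | _ => trivial

/-- The values of an environment over `Γ` are those of a substitution. -/
inductive EnvOk : Ctx → (ℕ → Tm) → Env → Prop
  | nil {Γ σ} : Der Γ ctx → EnvOk Γ σ .nil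
  | cons {Γ σ ρ v A} : Good Γ v A → EnvOk Γ σ ρ → EnvOk Γ (scons v σ) (.cons v A ρ)
  | wk {Γ σ ρ A} : Der Γ (ty A) → EnvOk Γ σ ρ → EnvOk (A :: Γ) (fun n => (σ n).wk) (.wk ρ)

namespace EnvOk

theorem ctx {Γ σ ρ} (h : EnvOk Γ σ ρ) : Der Γ ctx := by
  induction h with
  | nil h => exact h
  | cons _ _ ih => exact ih
  | wk hA => exact .cons hA.ctx hA

theorem lift {Γ σ ρ A} (h : EnvOk Γ σ ρ) (hA : Der Γ (ty A)) :
    EnvOk (A :: Γ) (liftSub σ) (ρ.lift A) := by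
  rw [liftSub_eq_scons]
  exact cons ⟨hA.var_zero, trivial⟩ (wk hA h)

theorem ofCtx {Γ} (h : Der Γ Judgment.ctx) : EnvOk Γ var (Env.ofCtx Γ) := by
  induction Γ with
  | nil => exact nil h
  | cons A Γ ih => simpa [Env.ofCtx] using (ih h.tail).lift h.head

/-- Weakenings of an environment are delayed and counted by `k`; the hypothesis `w` accumulates the
proofs that these weakenings preserve good values. -/
theorem get? {Γ σ ρ n k v T Δ} (h : EnvOk Γ σ ρ)
    (w : ∀ {t T}, Good Γ t T → Good Δ (t.rename (· + k)) (T.rename (· + k)))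
    (e : ρ.get? n k = some (v, T)) : v = (σ n).rename (· + k) ∧ Good Δ v T := by
  induction h generalizing n k with
  | nil => cases e
  | cons hv _ ih =>
    cases n with
    | zero => cases e; exact ⟨rfl, w hv⟩
    | succ n => exact ih w e
  | @wk Γ σ ρ A hA _ ih =>
    rw [rename_wk]
    exact ih (fun h => by simpa only [rename_wk] using w (h.wk hA)) e

end EnvOk

/-- Every answer is derivable. -/
structure Checker.Sound (r : Checker) : Prop where
  type {Γ σ ρ A A'} : EnvOk Γ σ ρ → r.type Γ ρ A = some A' → Der Γ (eqTy (A.subst σ) A')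
  infer {Γ σ ρ t n T} : EnvOk Γ σ ρ → r.infer Γ ρ t = some (n, T) →
    Der Γ (eqTm (t.subst σ) n T) ∧ Canonical Γ n T
  check {Γ σ ρ t n T} : EnvOk Γ σ ρ → Der Γ (ty T) → r.check Γ ρ t T = some n →
    Der Γ (eqTm (t.subst σ) n T) ∧ Canonical Γ n T

namespace Checker

variable {r : Checker} {Γ : Ctx} {σ : ℕ → Tm} {ρ : Env}

/-- A typing derivation alone does not show the premises of an introduction form. Checking the form
again with itself as result recovers them. -/
theorem Sound.certify (hr : r.Sound) {a A} (ha : Der Γ (tm a A)) (h : r.certify Γ a A = true) : Good Γ a A := by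
  refine ⟨ha, ?_⟩
  simp only [Checker.certify, Bool.or_eq_true] at h
  rcases h with h | h
  · exact .of_neutral h
  · split at h
    · next e =>
      obtain rfl := eq_of_beq h
      exact (hr.check (.ofCtx ha.ctx) ha.regular e).2
    · cases h

theorem Sound.inst (hr : r.Sound) {A B a R} (hB : Der (A :: Γ) (ty B)) (ha : Der Γ (tm a A))
    (h : r.inst Γ B a A = some R) : Der Γ (eqTy (B.inst a) R) := by
  simp only [Checker.inst, cond_eq_ite] at h
  split_ifs at h with h₁ h₂
  · cases h; exact (hB.inst_ty ha).ty_rfl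
  · rw [inst_eq]; exact hr.type (.cons (hr.certify ha h₂) (.ofCtx ha.ctx)) h

theorem Sound.inst₂ (hr : r.Sound) {A a b C p R} (hC : Der (.Id A.wk a.wk (var 0) :: A :: Γ) (ty C))
    (hb : Der Γ (tm b A)) (hp : Der Γ (tm p (.Id A a b)))
    (h : r.inst₂ Γ C b A p (.Id A a b) = some R) : Der Γ (eqTy (C.inst₂ b p) R) := by
  simp only [Checker.inst₂, cond_eq_ite, Bool.and_eq_true] at h
  split_ifs at h with h₁ h₂
  · cases h; exact (hC.inst₂_ty hb hp).ty_rfl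
  · rw [inst₂_eq]
    exact hr.type (.cons (hr.certify hp h₂.2) (.cons (hr.certify hb h₂.1) (.ofCtx hb.ctx))) h

theorem Sound.instTm (hr : r.Sound) {A B a b R t} (hb : Der (A :: Γ) (tm b B)) (ha : Der Γ (tm a A))
    (e : Der Γ (eqTy (B.inst a) R)) (h : r.instTm Γ b a A R = some t) :
    Der Γ (eqTm (b.inst a) t R) ∧ Canonical Γ t R := by
  simp only [Checker.instTm, cond_eq_ite, Bool.and_eq_true] at h
  split_ifs at h with h₁ h₂
  · cases h; exact ⟨((hb.inst_tm ha).conv e).tm_rfl, .of_neutral h₁.1⟩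
  · rw [inst_eq]
    exact hr.check (.cons (hr.certify ha h₂) (.ofCtx ha.ctx)) e.regular.2 h

theorem Sound.recheck (hr : r.Sound) {a t T} (ha : Der Γ (tm a T)) (h : r.recheck Γ a T = some t) :
    Der Γ (eqTm a t T) ∧ Canonical Γ t T := by
  simp only [Checker.recheck, cond_eq_ite, Bool.and_eq_true] at h
  split_ifs at h with h₁
  · cases h; exact ⟨ha.tm_rfl, .of_neutral h₁.1⟩
  · simpa using hr.check (.ofCtx ha.ctx) ha.regular h

theorem Sound.etaLam (hr : r.Sound) {A B b t} (hb : Der (A :: Γ) (tm b B)) (h : r.etaLam Γ A B b = some t) :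
    Der Γ (eqTm (lam A b) t (Pi A B)) ∧ Canonical Γ t (Pi A B) := by
  have hA := hb.ctx.head
  have default : Der Γ (eqTm (lam A b) (lam A b) (Pi A B)) ∧ Canonical Γ (lam A b) (Pi A B) :=
    ⟨(Der.lam hA hb).tm_rfl, B, rfl, hb⟩
  unfold Checker.etaLam at h
  split at h
  · next g =>
    simp only [cond_eq_ite] at h
    split_ifs at h with h₁
    · split at h
      · next f' T e =>
        split_ifs at h with h₂
        cases h
        obtain rfl := eq_of_beq h₂
        have := hr.infer (.ofCtx hA.ctx) e
        rw [subst_var] at this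
        refine ⟨?_, this.2⟩
        rw [← eq_of_beq h₁]
        exact this.1.regular.1.Pi_eta.tm_trans this.1
      · cases h
    · cases h; exact default
  · cases h; exact default

theorem Sound.etaPair (hr : r.Sound) {A B a b t} (hB : Der (A :: Γ) (ty B)) (ha : Der Γ (tm a A))
    (hb : Der Γ (tm b (B.inst a))) (h : r.etaPair Γ A B a b = some t) :
    Der Γ (eqTm (pair a b) t (Sig A B)) ∧ Canonical Γ t (Sig A B) := by
  have default : Der Γ (eqTm (pair a b) (pair a b) (Sig A B)) ∧ Canonical Γ (pair a b) (Sig A B) :=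
    ⟨(Der.pair hB ha hb).tm_rfl, A, B, rfl, ha, hb⟩
  unfold Checker.etaPair at h
  split at h
  · next p q =>
    simp only [cond_eq_ite] at h
    split_ifs at h with h₁
    · split at h
      · next p' T e =>
        split_ifs at h with h₂
        · cases h
          obtain rfl := eq_of_beq h₂
          have := hr.infer (.ofCtx ha.ctx) e
          rw [subst_var] at this
          refine ⟨?_, this.2⟩
          rw [← eq_of_beq h₁]
          exact this.1.regular.1.Sig_eta.tm_trans this.1
        · cases h; exact default
      · cases h
    · cases h; exact default
  · cases h; exact default

end Checker

/-! ### Soundness of one step of the checker -/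

namespace Checker

variable {r : Checker} {Γ : Ctx} {σ : ℕ → Tm} {ρ : Env}

theorem Sound.typeStep (hr : r.Sound) (hρ : EnvOk Γ σ ρ) {A A'} (h : r.typeStep Γ ρ A = some A') :
    Der Γ (eqTy (A.subst σ) A') := by
  unfold Checker.typeStep at h
  split at h
  · cases h; exact (Der.U_ty hρ.ctx).ty_rfl
  · simp only [Option.bind_eq_bind, Option.bind_eq_some_iff, Option.some.injEq] at h
    obtain ⟨A', hA, B', hB, rfl⟩ := h
    have hA := hr.type hρ hA
    have hB := hr.type (hρ.lift hA.regular.2) hB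
    exact .Pi_eqTy hA.regular.1 hA (hB.ctx_conv hA.regular.1 hA.ty_symm)
  · simp only [Option.bind_eq_bind, Option.bind_eq_some_iff, Option.some.injEq] at h
    obtain ⟨A', hA, B', hB, rfl⟩ := h
    have hA := hr.type hρ hA
    have hB := hr.type (hρ.lift hA.regular.2) hB
    exact .Sig_eqTy hA.regular.1 hA (hB.ctx_conv hA.regular.1 hA.ty_symm)
  · simp only [Option.bind_eq_bind, Option.bind_eq_some_iff, Option.some.injEq] at h
    obtain ⟨A', hA, a', ha, b', hb, rfl⟩ := h
    have hA := hr.type hρ hA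
    have ha := (hr.check hρ hA.regular.2 ha).1
    have hb := (hr.check hρ hA.regular.2 hb).1
    exact .Id_eqTy hA (ha.conv_eq hA.ty_symm) (hb.conv_eq hA.ty_symm)
  · split at h
    · next e => cases h; exact (hr.infer hρ e).1.el_eq
    · cases h

theorem Sound.checkStep (hr : r.Sound) (hρ : EnvOk Γ σ ρ) {t T n} (hT : Der Γ (ty T))
    (h : r.checkStep Γ ρ t T = some n) :
    Der Γ (eqTm (t.subst σ) n T) ∧ Canonical Γ n T := by
  unfold Checker.checkStep at h
  split at h
  · next A b A₀ B =>
    simp only [Option.bind_eq_bind, Option.bind_eq_some_iff, cond_eq_ite] at h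
    obtain ⟨A', hA, h⟩ := h
    split_ifs at h with h₁
    obtain rfl := eq_of_beq h₁
    obtain ⟨b', hb, h⟩ := Option.bind_eq_some_iff.1 h
    have hA := hr.type hρ hA
    have hb := (hr.check (hρ.lift hA.regular.2) hT.Pi_inv.2 hb).1
    have h := hr.etaLam hb.regular.2.1 h
    refine ⟨Der.tm_trans (.conv_eq (.lam_eq hA.regular.1 hA (hb.ctx_conv hA.regular.1 hA.ty_symm))
      ?_) h.1, h.2⟩
    exact .Pi_eqTy hA.regular.1 hA (hT.Pi_inv.2.ctx_conv hA.regular.1 hA.ty_symm).ty_rfl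
  · next a b A B =>
    simp only [Option.bind_eq_bind, Option.bind_eq_some_iff] at h
    obtain ⟨a', ha, R, hR, b', hb, h⟩ := h
    have hB := hT.Sig_inv.2
    have ha := (hr.check hρ hT.Sig_inv.1 ha).1
    have hR := hr.inst hB ha.regular.2.1 hR
    have hb := (hr.check hρ hR.regular.2 hb).1.conv_eq hR.ty_symm
    have h := hr.etaPair hB ha.regular.2.1 hb.regular.2.1 h
    refine ⟨Der.tm_trans (.pair_eq hB ha (hb.conv_eq ?_)) h.1, h.2⟩
    exact hB.inst_congr ha.regular.2.1 ha.regular.1 ha.tm_symm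
  · next a A b c =>
    simp only [Option.bind_eq_bind, Option.bind_eq_some_iff, cond_eq_ite] at h
    obtain ⟨a', ha, h⟩ := h
    split_ifs at h with h₁
    cases h
    rw [Bool.and_eq_true] at h₁
    obtain rfl := eq_of_beq h₁.1
    obtain rfl := eq_of_beq h₁.2
    have ha := (hr.check hρ hT.Id_inv.1 ha).1
    exact ⟨(Der.refl_eq ha).conv_eq (.Id_eqTy ha.regular.2.2.ty_rfl ha ha), A, rfl⟩
  · simp only [Option.bind_eq_bind, Option.bind_eq_some_iff, cond_eq_ite] at h
    obtain ⟨⟨t', T'⟩, ht, h⟩ := h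
    dsimp only at h
    split_ifs at h with h₁
    cases h
    obtain rfl := eq_of_beq h₁
    exact hr.infer hρ ht

theorem Sound.inferStep (hr : r.Sound) (hρ : EnvOk Γ σ ρ) {t n T} (h : r.inferStep Γ ρ t = some (n, T)) :
    Der Γ (eqTm (t.subst σ) n T) ∧ Canonical Γ n T := by
  unfold Checker.inferStep at h
  split at h
  · next n =>
    obtain ⟨rfl, h⟩ := hρ.get? (Δ := Γ) (fun h => by simpa using h) h
    have e : (σ n).rename (· + 0) = σ n := Tm.rename_id _
    rw [e] at h ⊢
    exact ⟨h.typed.tm_rfl, h.canonical⟩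
  · simp only [Option.bind_eq_bind, Option.bind_eq_some_iff, Option.some.injEq, Prod.mk.injEq] at h
    obtain ⟨A', hA, B', hB, rfl, rfl⟩ := h
    have hU := Der.U_ty hρ.ctx
    have hA := (hr.check hρ hU hA).1
    have hρ' := hρ.lift hA.regular.2.1.el
    have hB := (hr.check hρ' (.U_ty hρ'.ctx) hB).1
    exact ⟨.Pi_eqU hA.regular.1 hA (hB.ctx_conv hA.regular.1.el hA.el_eq.ty_symm), trivial⟩
  · simp only [Option.bind_eq_bind, Option.bind_eq_some_iff, Option.some.injEq, Prod.mk.injEq] at h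
    obtain ⟨A', hA, B', hB, rfl, rfl⟩ := h
    have hU := Der.U_ty hρ.ctx
    have hA := (hr.check hρ hU hA).1
    have hρ' := hρ.lift hA.regular.2.1.el
    have hB := (hr.check hρ' (.U_ty hρ'.ctx) hB).1
    exact ⟨.Sig_eqU hA.regular.1 hA (hB.ctx_conv hA.regular.1.el hA.el_eq.ty_symm), trivial⟩
  · simp only [Option.bind_eq_bind, Option.bind_eq_some_iff, Option.some.injEq, Prod.mk.injEq] at h
    obtain ⟨A', hA, a', ha, b', hb, rfl, rfl⟩ := h
    have hA := (hr.check hρ (.U_ty hρ.ctx) hA).1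
    have hA' := hA.regular.2.1.el
    have ha := (hr.check hρ hA' ha).1
    have hb := (hr.check hρ hA' hb).1
    exact ⟨.Id_eqU hA (ha.conv_eq hA.el_eq.ty_symm) (hb.conv_eq hA.el_eq.ty_symm), trivial⟩
  · simp only [Option.bind_eq_bind, Option.bind_eq_some_iff, Option.some.injEq, Prod.mk.injEq] at h
    obtain ⟨A', hA, ⟨b', B⟩, hb, t, h, rfl, rfl⟩ := h
    have hA := hr.type hρ hA
    have hb := (hr.infer (hρ.lift hA.regular.2) hb).1
    have h := hr.etaLam hb.regular.2.1 h
    refine ⟨Der.tm_trans (.conv_eq (.lam_eq hA.regular.1 hA (hb.ctx_conv hA.regular.1 hA.ty_symm))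
      ?_) h.1, h.2⟩
    exact .Pi_eqTy hA.regular.1 hA (hb.regular.2.2.ctx_conv hA.regular.1 hA.ty_symm).ty_rfl
  · simp only [Option.bind_eq_bind, Option.bind_eq_some_iff] at h
    obtain ⟨⟨f', F⟩, hf, h⟩ := h
    split at h
    · next A B e =>
      cases e
      simp only [Option.bind_eq_some_iff] at h
      obtain ⟨a', ha, R, hR, h⟩ := h
      have hf := hr.infer hρ hf
      have hAB := hf.1.regular.2.2.Pi_inv
      have ha := (hr.check hρ hAB.1 ha).1
      have hR := hr.inst hAB.2 ha.regular.2.1 hR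
      have happ := ((hf.1.app_eq ha).conv_eq
        (hAB.2.inst_congr ha.regular.1 ha.regular.2.1 ha)).conv_eq hR
      split at h
      · next A' b =>
        simp only [Option.bind_eq_some_iff, Option.some.injEq, Prod.mk.injEq] at h
        obtain ⟨t, h, rfl, rfl⟩ := h
        -- The canonical evidence types the body over exactly the domain and codomain of the
        -- computed `Π` type, so injectivity of `Π` is not needed.
        obtain ⟨B', e, hb⟩ := hf.2
        cases e
        have h := hr.instTm hb ha.regular.2.1 hR h
        exact ⟨(happ.tm_trans ((Der.Pi_beta hAB.1 hb ha.regular.2.1).conv_eq hR)).tm_trans h.1, h.2⟩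
      · cases h
        exact ⟨happ, trivial⟩
    · cases h
  · simp only [Option.bind_eq_bind, Option.bind_eq_some_iff, Option.some.injEq, Prod.mk.injEq] at h
    obtain ⟨⟨a', A⟩, ha, ⟨b', B⟩, hb, t, h, rfl, rfl⟩ := h
    have ha := (hr.infer hρ ha).1
    have hb := (hr.infer hρ hb).1
    have hB := hb.regular.2.2.wk_ty ha.regular.2.2
    have h := hr.etaPair hB ha.regular.2.1 (by simpa using hb.regular.2.1) h
    exact ⟨(Der.pair_eq hB ha (by simpa using hb)).tm_trans h.1, h.2⟩
  · simp only [Option.bind_eq_bind, Option.bind_eq_some_iff] at h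
    obtain ⟨⟨p', P⟩, hp, h⟩ := h
    split at h
    · next A B e =>
      cases e
      have hp := hr.infer hρ hp
      have hB := hp.1.regular.2.2.Sig_inv.2
      split at h
      · next a b =>
        simp only [Option.bind_eq_some_iff, Option.some.injEq, Prod.mk.injEq] at h
        obtain ⟨t, h, rfl, rfl⟩ := h
        obtain ⟨_, _, e, ha, hb⟩ := hp.2
        cases e
        have h := hr.recheck ha h
        exact ⟨(hp.1.fst_eq.tm_trans (.fst_beta hB ha hb)).tm_trans h.1, h.2⟩
      · cases h
        exact ⟨hp.1.fst_eq, trivial⟩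
    · cases h
  · simp only [Option.bind_eq_bind, Option.bind_eq_some_iff] at h
    obtain ⟨⟨p', P⟩, hp, h⟩ := h
    split at h
    · next A B e =>
      cases e
      have hp := hr.infer hρ hp
      have hB := hp.1.regular.2.2.Sig_inv.2
      have hfst := hp.1.fst_eq
      have hsnd := hp.1.snd_eq.conv_eq (hB.inst_congr hfst.regular.1 hfst.regular.2.1 hfst)
      split at h
      · next a b =>
        simp only [Option.bind_eq_some_iff, Option.some.injEq, Prod.mk.injEq] at h
        obtain ⟨R, hR, t, h, rfl, rfl⟩ := h
        obtain ⟨_, _, e, ha, hb⟩ := hp.2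
        cases e
        have hR := hr.inst hB ha hR
        have h := hr.recheck (hb.conv hR) h
        have hβ := hB.inst_congr hfst.regular.2.1 ha (.fst_beta hB ha hb)
        exact ⟨((hsnd.conv_eq (hβ.ty_trans hR)).tm_trans
          ((Der.snd_beta hB ha hb).conv_eq hR)).tm_trans h.1, h.2⟩
      · simp only [Option.bind_eq_some_iff, Option.some.injEq, Prod.mk.injEq] at h
        obtain ⟨R, hR, rfl, rfl⟩ := h
        exact ⟨hsnd.conv_eq (hr.inst hB hfst.regular.2.1 hR), trivial⟩
    · cases h
  · simp only [Option.bind_eq_bind, Option.bind_eq_some_iff, Option.some.injEq, Prod.mk.injEq] at h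
    obtain ⟨⟨a', A⟩, ha, rfl, rfl⟩ := h
    have ha := (hr.infer hρ ha).1
    exact ⟨(Der.refl_eq ha).conv_eq (.Id_eqTy ha.regular.2.2.ty_rfl ha ha), A, rfl⟩
  · simp only [Option.bind_eq_bind, Option.bind_eq_some_iff] at h
    obtain ⟨⟨p', P⟩, hp, h⟩ := h
    split at h
    · next A a b e =>
      cases e
      simp only [Option.bind_eq_some_iff] at h
      obtain ⟨C', hC, D, hD, d', hd, h⟩ := h
      have hp := hr.infer hρ hp
      obtain ⟨hA, ha, hb⟩ := hp.1.regular.2.2.Id_inv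
      have hP := Der.Id_ty (hA.wk_ty hA) (ha.wk_tm hA) hA.var_zero
      have hC := hr.type ((hρ.lift hA).lift hP) hC
      have hD := hr.inst₂ hC.regular.2 ha (.refl ha) hD
      have hd := hr.check hρ hD.regular.2 hd
      have hJ := (Der.J_eq ha hC (hd.1.conv_eq (hD.ty_symm.ty_trans
        (hC.inst₂_eqTy ha (.refl ha)).ty_symm)) hb hp.1).conv_eq
        ((hC.regular.1.inst₂_congr hb hp.1.regular.1 hp.1.regular.2.1 hp.1).ty_trans
          (hC.inst₂_eqTy hb hp.1.regular.2.1))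
      split at h
      · next a' =>
        cases h
        -- The canonical evidence identifies both endpoints with the term under `refl`, as the `β`
        -- rule for `J` demands.
        obtain ⟨_, e⟩ := hp.2
        cases e
        exact ⟨(hJ.conv_eq hD).tm_trans ((Der.J_beta ha hC.regular.2
          (hd.1.regular.2.1.conv hD.ty_symm)).conv_eq hD), hd.2⟩
      · simp only [Option.bind_eq_some_iff, Option.some.injEq, Prod.mk.injEq] at h
        obtain ⟨R, hR, rfl, rfl⟩ := h
        exact ⟨hJ.conv_eq (hr.inst₂ hC.regular.2 hb hp.1.regular.2.1 hR), trivial⟩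
    · cases h
  · cases h

theorem run_sound (n : ℕ) : (run n).Sound := by
  induction n with
  | zero => constructor <;> intros <;> contradiction
  | succ n ih => exact ⟨fun hρ h => ih.typeStep hρ h, fun hρ h => ih.inferStep hρ h, fun hρ hT h => ih.checkStep hρ hT h⟩

end Checker

theorem derives_sound {n t A} (h : derives n t A = true) : Der [] (tm t A) := by
  unfold derives at h
  split at h
  · next A' hA =>
    obtain ⟨t', ht⟩ := Option.isSome_iff_exists.1 h
    have hr := Checker.run_sound n
    have hA := hr.type (σ := var) (.nil .nil) hA
    have ht := (hr.check (σ := var) (.nil .nil) hA.regular.2 ht).1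
    rw [subst_var] at hA ht
    exact ht.regular.1.conv hA.ty_symm
  · cases h

/-! ## Higher-order abstract syntax -/

/-- Expressions written with bound variables of the metalanguage: the raw expression at each
number of enclosing binders. -/
structure HTm where
  atDepth : ℕ → Tm

namespace HTm

/-- The variable bound under `n` binders. -/
def bound (n : ℕ) : HTm := ⟨fun m => Tm.var (m - (n + 1))⟩

/-- A closed raw expression. -/
def lit (t : Tm) : HTm := ⟨fun _ => t⟩

def close (t : HTm) : Tm := t.atDepth 0

def U : HTm := ⟨fun _ => Tm.U⟩

def pi (A : HTm) (B : HTm → HTm) : HTm :=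
  ⟨fun n => Tm.Pi (A.atDepth n) ((B (bound n)).atDepth (n + 1))⟩

def lam (A : HTm) (b : HTm → HTm) : HTm :=
  ⟨fun n => Tm.lam (A.atDepth n) ((b (bound n)).atDepth (n + 1))⟩

def sig (A : HTm) (B : HTm → HTm) : HTm :=
  ⟨fun n => Tm.Sig (A.atDepth n) ((B (bound n)).atDepth (n + 1))⟩

def app (f a : HTm) : HTm := ⟨fun n => Tm.app (f.atDepth n) (a.atDepth n)⟩

instance : CoeFun HTm fun _ => HTm → HTm := ⟨app⟩

def pair (a b : HTm) : HTm := ⟨fun n => Tm.pair (a.atDepth n) (b.atDepth n)⟩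

def fst (p : HTm) : HTm := ⟨fun n => Tm.fst (p.atDepth n)⟩

def snd (p : HTm) : HTm := ⟨fun n => Tm.snd (p.atDepth n)⟩

def id (A a b : HTm) : HTm := ⟨fun n => Tm.Id (A.atDepth n) (a.atDepth n) (b.atDepth n)⟩

def refl (a : HTm) : HTm := ⟨fun n => Tm.refl (a.atDepth n)⟩

def J (C : HTm → HTm → HTm) (d p : HTm) : HTm :=
  ⟨fun n => Tm.J ((C (bound n) (bound (n + 1))).atDepth (n + 2)) (d.atDepth n) (p.atDepth n)⟩

/-! ### Homotopies and equivalences in higher-order syntax -/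

def arrow (A B : HTm) : HTm := pi A fun _ => B

def prod (A B : HTm) : HTm := sig A fun _ => B

def htpy (A : HTm) (B : HTm → HTm) (f g : HTm) : HTm := pi A fun x => id (B x) (f x) (g x)

def idFun (A : HTm) : HTm := lam A fun x => x

def comp (A : HTm) (g f : HTm → HTm) : HTm := lam A fun x => g (f x)

/-- Composites are written with their `β` redexes already contracted, and `f` is a function of the
metalanguage so that applying it need not create a redex. The checker matches this with
`ITT.isEquiv` by computation. -/
def isEquiv (A B : HTm) (f : HTm → HTm) : HTm :=
  prod (sig (arrow B A) fun s => pi B fun b => id B (f (s b)) b)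
    (sig (arrow B A) fun r => pi A fun a => id A (r (f a)) a)

/-- The section of an equivalence. -/
def sec (e : HTm) : HTm := fst (fst e)

def secHtpy (e : HTm) : HTm := snd (fst e)

/-- The retraction of an equivalence. -/
def ret (e : HTm) : HTm := fst (snd e)

def retHtpy (e : HTm) : HTm := snd (snd e)

/-- For each `b : B`, some `a` with `f a = b`, and some `a'` equal to every `a` with `f a = b`. -/
def Invertible (A B : HTm) (f : HTm → HTm) : HTm :=
  pi B fun b => prod (sig A fun a => id B (f a) b)
    (sig A fun a' => pi A fun a => arrow (id B (f a) b) (id A a' a))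

/-! ### Equivalences as structured functions -/

/-- The type of triples of `f : T`, `s : S` with `P f s`, and `r : R` with `Q f r`. -/
def total (T S R : HTm) (P Q : HTm → HTm → HTm) : HTm :=
  sig T fun f => prod (sig S fun s => P f s) (sig R fun r => Q f r)

def tuple (f s h r k : HTm) : HTm := pair f (pair (pair s h) (pair r k))

/-- Change the data of an element of `total`, leaving `f`, `s` and `r` alone. -/
def mapData (F G : HTm → HTm → HTm → HTm) (z : HTm) : HTm :=
  tuple (fst z) (fst (fst (snd z))) (F (fst z) (fst (fst (snd z))) (snd (fst (snd z))))
    (fst (snd (snd z))) (G (fst z) (fst (snd (snd z))) (snd (snd (snd z))))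

def equiv (A B : HTm) : HTm := sig (arrow A B) fun f => isEquiv A B f

def catEquiv (A B : HTm) : HTm :=
  total (arrow A B) (arrow B A) (arrow B A)
    (fun f s => id (arrow B B) (comp B f s) (idFun B))
    (fun f r => id (arrow A A) (comp A r f) (idFun A))

def idHtpy (A : HTm) : HTm := lam A fun x => refl x

def idEquiv (A : HTm) : HTm := tuple (idFun A) (idFun A) (idHtpy A) (idFun A) (idHtpy A)

def idCatEquiv (A : HTm) : HTm :=
  tuple (idFun A) (idFun A) (refl (idFun A)) (idFun A) (refl (idFun A))

def happly (A : HTm) (B : HTm → HTm) (f p : HTm) : HTm :=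
  J (fun g _ => htpy A B f g) (lam A fun x => refl (f x)) p

/-- The map from categorical equivalences to equivalences. -/
def forget (A B : HTm) : HTm → HTm :=
  mapData (fun f s => happly B (fun _ => B) (comp B f s))
    (fun f r => happly A (fun _ => A) (comp A r f))

/-- A map of families induces an invertible map on `total` if it is a fibrewise equivalence. -/
def TotalInvertible : HTm :=
  pi U fun T => pi U fun S => pi U fun R =>
  pi (arrow T (arrow S U)) fun P => pi (arrow T (arrow S U)) fun P' =>
  pi (arrow T (arrow R U)) fun Q => pi (arrow T (arrow R U)) fun Q' =>
  pi (pi T fun f => pi S fun s => arrow (P f s) (P' f s)) fun a =>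
  pi (pi T fun f => pi R fun r => arrow (Q f r) (Q' f r)) fun b =>
  arrow (pi T fun f => pi S fun s => isEquiv (P f s) (P' f s) (a f s)) <|
  arrow (pi T fun f => pi R fun r => isEquiv (Q f r) (Q' f r) (b f r)) <|
  Invertible (total T S R (P ·) (Q ·)) (total T S R (P' ·) (Q' ·))
    (mapData (fun f s => a f s) (fun f r => b f r))

/-- The sections and retractions of the fibrewise equivalences act on the proofs only. The functions
`f`, `s`, `r` stay strictly fixed, so no transport between fibres is needed. -/
def totalInvertible : HTm :=
  lam U fun T => lam U fun S => lam U fun R =>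
  lam (arrow T (arrow S U)) fun P => lam (arrow T (arrow S U)) fun P' =>
  lam (arrow T (arrow R U)) fun Q => lam (arrow T (arrow R U)) fun Q' =>
  lam (pi T fun f => pi S fun s => arrow (P f s) (P' f s)) fun a =>
  lam (pi T fun f => pi R fun r => arrow (Q f r) (Q' f r)) fun b =>
  lam (pi T fun f => pi S fun s => isEquiv (P f s) (P' f s) (a f s)) fun i =>
  lam (pi T fun f => pi R fun r => isEquiv (Q f r) (Q' f r) (b f r)) fun j =>
  let Y := total T S R (P ·) (Q ·)
  let Z := total T S R (P' ·) (Q' ·)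
  let φ := mapData (fun f s => a f s) (fun f r => b f r)
  let f z := fst z
  let s z := fst (fst (snd z))
  let h z := snd (fst (snd z))
  let r z := fst (snd (snd z))
  let k z := snd (snd (snd z))
  -- Two path inductions join tuples with the same functions, one for each proof. Strict `η` for `Σ`
  -- identifies the final tuple with `z`.
  let path (X z h' k' p q : HTm) :=
    J (fun y _ => id X (tuple (f z) (s z) h' (r z) k') (tuple (f z) (s z) y (r z) (k z)))
      (J (fun y _ => id X (tuple (f z) (s z) h' (r z) k') (tuple (f z) (s z) h' (r z) y))
        (refl (tuple (f z) (s z) h' (r z) k')) q) p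
  let i z := i (f z) (s z)
  let j z := j (f z) (r z)
  let a z := a (f z) (s z)
  let b z := b (f z) (r z)
  let ρ z := tuple (f z) (s z) (ret (i z) (h z)) (r z) (ret (j z) (k z))
  lam Z fun z => pair
    (pair (tuple (f z) (s z) (sec (i z) (h z)) (r z) (sec (j z) (k z)))
      (path Z z (a z (sec (i z) (h z))) (b z (sec (j z) (k z)))
        (secHtpy (i z) (h z)) (secHtpy (j z) (k z))))
    (pair (ρ z) (lam Y fun y => lam (id Z (φ y) z) fun p =>
      -- Induction on `φ y = z` replaces `z` by `φ y`, where `ρ (φ y)` computes and the fibrewise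
      -- retractions apply.
      J (fun z _ => id Y (ρ z) y)
        (path Y y (ret (i y) (a y (h y))) (ret (j y) (b y (k y)))
          (retHtpy (i y) (h y)) (retHtpy (j y) (k y))) p))

def ForgetInvertible : HTm :=
  pi U fun A => pi U fun B => Invertible (catEquiv A B) (equiv A B) (forget A B)

/-- Function extensionality makes `happly` an equivalence on each proof component; the constant
families `B` over `B` and `A` over `A` suffice. -/
def forgetInvertible : HTm :=
  lam TotalInvertible fun t => lam (lit ITT.FE) fun fe => lam U fun A => lam U fun B =>
  let T := arrow A B
  let S := arrow B A
  let fam (C : HTm → HTm → HTm) := lam T fun f => lam S fun s => C f s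
  let P (f s : HTm) := id (arrow B B) (comp B f s) (idFun B)
  let Q (f r : HTm) := id (arrow A A) (comp A r f) (idFun A)
  t T S S (fam P) (fam fun f s => htpy B (fun _ => B) (comp B f s) (idFun B))
    (fam Q) (fam fun f r => htpy A (fun _ => A) (comp A r f) (idFun A))
    (fam fun f s => lam (P f s) (happly B (fun _ => B) (comp B f s)))
    (fam fun f r => lam (Q f r) (happly A (fun _ => A) (comp A r f)))
    (fam fun f s => fe B (lam B fun _ => B) (comp B f s) (idFun B))
    (fam fun f r => fe A (lam A fun _ => A) (comp A r f) (idFun A))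

/-! ### Transfer of univalence along invertible maps -/

/-- Transport of `y : Y A` along `p : A = B`. -/
def transport (Y : HTm → HTm) (y p : HTm) : HTm := J (fun B _ => Y B) y p

/-- The maps `(A = B) → Y B` given by transport of `y : Y A` are equivalences. -/
def Represented (A : HTm) (Y : HTm → HTm) (y : HTm) : HTm :=
  pi U fun B => isEquiv (id U A B) (Y B) (transport Y y)

/-- Bind type families `Y`, `Z` with elements over `A`, and an invertible map between them that
preserves these elements. -/
def bindMap (bind : HTm → (HTm → HTm) → HTm)
    (body : HTm → HTm → HTm → HTm → HTm → HTm → HTm → HTm → HTm) : HTm :=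
  bind U fun A => bind (arrow U U) fun Y => bind (arrow U U) fun Z =>
  bind (Y A) fun y => bind (Z A) fun z =>
  bind (pi U fun B => arrow (Y B) (Z B)) fun φ => bind (id (Z A) z (φ A y)) fun t =>
  bind (pi U fun B => Invertible (Y B) (Z B) (φ B)) fun e => body A Y Z y z φ t e

def TransferForward : HTm :=
  bindMap pi fun A Y Z y z _ _ _ => arrow (Represented A Y y) (Represented A Z z)

def TransferBackward : HTm :=
  bindMap pi fun A Y Z y z _ _ _ => arrow (Represented A Z z) (Represented A Y y)

/-- The map `φ` commutes with transport. -/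
def triangle (Y Z φ y z t p : HTm) : HTm :=
  J (fun B q => id (Z B) (transport Z z q) (φ B (transport Y y q))) t p

/-- Up to homotopy `m` is `φ ∘ k`, so a section of `m` is a section of `φ` followed by one of `k`,
and a retraction of `m` is a retraction of `φ` followed by one of `k`. -/
def transferForward : HTm := bindMap lam fun A Y Z y₀ z₀ φ t e =>
  lam (Represented A Y y₀) fun v => lam U fun B =>
  let X := id U A B
  let k := transport Y y₀
  let m := transport Z z₀
  let tri := triangle Y Z φ y₀ z₀ t
  let φ := φ B
  let e := e B
  let v := v B
  let s z := fst (fst (e z))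
  let r z := fst (snd (e z))
  pair
    (pair (lam (Z B) fun z => sec v (s z)) (lam (Z B) fun z =>
      let x := sec v (s z)
      J (fun w _ => id (Z B) (m x) w)
        (J (fun y _ => id (Z B) (m x) (φ y)) (tri x) (secHtpy v (s z)))
        (snd (fst (e z)))))
    (pair (lam (Z B) fun z => ret v (r z)) (lam X fun x =>
      let l := ret v (r (m x))
      J (fun w _ => id X l w)
        (J (fun y _ => id X l (ret v y))
          (J (fun z _ => id X l (ret v (r z))) (refl l) (tri x))
          (snd (snd (e (φ (k x)))) (k x) (refl (φ (k x)))))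
        (retHtpy v x)))

/-- Here `k` is cancelled from `m ∼ φ ∘ k`: its section and retraction are those of `m` precomposed
with `φ`. For the section, with `x = sec u (φ y)`, the chain is `k x = r (φ (k x)) = r (m x) = r (φ
y) = y`. -/
def transferBackward : HTm := bindMap lam fun A Y Z y₀ z₀ φ t e =>
  lam (Represented A Z z₀) fun u => lam U fun B =>
  let X := id U A B
  let k := transport Y y₀
  let m := transport Z z₀
  let tri := triangle Y Z φ y₀ z₀ t
  let φ := φ B
  let e := e B
  let u := u B
  let r z := fst (snd (e z))
  let rHtpy y := snd (snd (e (φ y))) y (refl (φ y))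
  pair
    (pair (lam (Y B) fun y => sec u (φ y)) (lam (Y B) fun y =>
      let x := sec u (φ y)
      let l := r (m x)
      J (fun w _ => id (Y B) w y)
        (J (fun z _ => id (Y B) (r z) y)
          (J (fun w _ => id (Y B) l w)
            (J (fun z _ => id (Y B) l (r z)) (refl l) (secHtpy u (φ y)))
            (rHtpy y))
          (tri x))
        (rHtpy (k x))))
    (pair (lam (Y B) fun y => ret u (φ y)) (lam X fun x =>
      J (fun z _ => id X (ret u z) x) (retHtpy u x) (tri x)))

/-- Apply a transfer principle to `forget`. -/
def transferForget (T : HTm) (V : Tm) : HTm :=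
  lam T fun t => lam ForgetInvertible fun e => lam (lit V) fun v => lam U fun A =>
    t A (lam U fun B => catEquiv A B) (lam U fun B => equiv A B) (idCatEquiv A) (idEquiv A)
      -- Reflexivity suffices because `happly` computes on `refl`, so `forget` sends `idCatEquiv A`
      -- strictly to `idEquiv A`.
      (lam U fun B => lam (catEquiv A B) (forget A B)) (refl (idEquiv A)) (e A) (v A)

/-! ### Function extensionality from univalence -/

/-- The type of `p : f = g` that induce a given homotopy. -/
def PathOver (A : HTm) (B : HTm → HTm) (f g h : HTm) : HTm :=
  sig (id (pi A B) f g) fun p => id (htpy A B f g) (happly A B f p) h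

/-- Every homotopy is induced by a path. -/
def NaiveFunext : HTm :=
  pi U fun A => pi (arrow A U) fun B => pi (pi A B) fun f => pi (pi A B) fun g =>
  pi (htpy A B f g) fun h => PathOver A B f g h

/-- With `W` the type of `x : A`, `y : B x` and paths `f x = y`, the projection `W → A` is an
equivalence. By univalence the fibre over `id` of postcomposition with it is a proposition, and
homotopies with source `f` are elements of this fibre. -/
def naiveFunext : HTm :=
  lam (lit ITT.UA) fun ua => lam U fun A => lam (arrow A U) fun B =>
  lam (pi A B) fun f => lam (pi A B) fun g => lam (htpy A B f g) fun h =>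
  let F x := sig (B x) fun y => id (B x) (f x) y
  let W := sig A F
  let s x := pair x (pair (f x) (refl (f x)))
  let e := tuple (lam W fst) (lam A s) (idHtpy A) (lam A s)
    (lam W fun w => J (fun y q => id W (s (fst w)) (pair (fst w) (pair y q)))
      (refl (s (fst w))) (snd (snd w)))
  let fibre (Y c v : HTm) := sig (arrow A W) fun u => id (arrow A Y) (comp A c u) v
  let D (Y c : HTm) := pi (arrow A Y) fun v =>
    pi (fibre Y c v) fun t => pi (fibre Y c v) fun t' => id (fibre Y c v) t t'
  -- By strict `η`, postcomposition with the identity of `W` is the identity, so its fibre over `v`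
  -- is the singleton of functions equal to `v`. Any two elements are joined through `(v, refl)`.
  let base :=
    let S := fibre W (idFun W)
    lam (arrow A W) fun v => lam (S v) fun t => lam (S v) fun t' =>
      let contr (t : HTm) := J (fun y q => id (S y) (pair (fst t) q) (pair y (refl y)))
        (refl (pair (fst t) (refl (fst t)))) (snd t)
      J (fun y _ => arrow (id (S v) t y) (id (S v) t t')) (idFun (id (S v) t t'))
        (contr t') (contr t)
  -- Univalence supplies a path `W = A`. Path induction along it starts from the identity, and
  -- `secHtpy` identifies the resulting equivalence with `e`.
  let d := J (fun y _ => D A (fst y))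
    (J (fun Y p => D Y (fst (transport (equiv W) (idEquiv W) p))) base (sec (ua W A) e))
    (secHtpy (ua W A) e)
  -- Both functions into `W` have first component `x` at `x`, so their composites with the
  -- projection are strictly the identity and `refl` witnesses membership in the fibre.
  let p := d (idFun A) (pair (lam A s) (refl (idFun A)))
    (pair (lam A fun x => pair x (pair (g x) (h x))) (refl (idFun A)))
  -- An element of the fibre lands over `x` only up to a path, along which its second component is
  -- transported. At the two elements joined by `p` that path is `refl`, so the values compute to
  -- `(f x, refl)` and `(g x, h x)`.
  let section' (t x : HTm) := J (fun y _ => F y) (snd (fst t x))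
    (J (fun y _ => id A (fst (fst t x)) (y x)) (refl (fst (fst t x))) (snd t))
  J (fun t _ => PathOver A B f (lam A fun x => fst (section' t x))
      (lam A fun x => snd (section' t x)))
    (pair (refl f) (refl (lam A fun x => refl (f x)))) p

/-- The path `l : f = f` chosen for the trivial homotopy need not be `refl`. Composing every chosen
path with the inverse of `l` gives `ext`, whose value at `refl` becomes `l⁻¹ · l`; induction on `p`
and then on `l` makes it a retraction of `happly`. -/
def funextOfNaive : HTm :=
  lam NaiveFunext fun n => lam U fun A => lam (arrow A U) fun B =>
  lam (pi A B) fun f => lam (pi A B) fun g =>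
  let n := n A B f
  let l := fst (n f (lam A fun x => refl (f x)))
  let ext g h := J (fun y _ => id (pi A B) y g) (fst (n g h)) l
  pair
    (pair (lam (htpy A B f g) fun h => fst (n g h)) (lam (htpy A B f g) fun h => snd (n g h)))
    (pair (lam (htpy A B f g) fun h => ext g h) (lam (id (pi A B) f g) fun p =>
      J (fun g p => id (id (pi A B) f g) (ext g (happly A B f p)) p)
        (J (fun g q => id (id (pi A B) g g) (J (fun y _ => id (pi A B) y g) q q) (refl g))
          (refl (refl f)) l) p))

def combine : HTm :=
  lam (arrow (lit UA) NaiveFunext) fun n => lam (arrow NaiveFunext (lit FE)) fun f =>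
  lam (arrow (lit FE) ForgetInvertible) fun i =>
  lam (arrow ForgetInvertible (arrow (lit CUA) (lit UA))) fun u =>
  lam (arrow ForgetInvertible (arrow (lit UA) (lit CUA))) fun c =>
  pair (lam (lit UA) fun v => pair (c (i (f (n v))) v) (f (n v)))
    (lam (prod (lit CUA) (lit FE)) fun p => u (i (snd p)) (fst p))

end HTm

/-! ### Running the checker and combining the closed terms -/

open HTm in
theorem provable_totalInvertible : Provable TotalInvertible.close :=
  -- The bound 100 is recursion fuel with no mathematical meaning; soundness holds for every bound.
  ⟨_, derives_sound (n := 100) (t := totalInvertible.close) (by decide +kernel)⟩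

open HTm in
theorem provable_forgetInvertible :
    Provable (ITT.arrow TotalInvertible.close (ITT.arrow FE ForgetInvertible.close)) :=
  ⟨_, derives_sound (n := 100) (t := forgetInvertible.close) (by decide +kernel)⟩

open HTm in
theorem provable_transferForward : Provable TransferForward.close :=
  ⟨_, derives_sound (n := 100) (t := transferForward.close) (by decide +kernel)⟩

open HTm in
theorem provable_transferBackward : Provable TransferBackward.close :=
  ⟨_, derives_sound (n := 100) (t := transferBackward.close) (by decide +kernel)⟩

open HTm in
theorem provable_univalence : Provable (ITT.arrow TransferForward.close
    (ITT.arrow ForgetInvertible.close (ITT.arrow CUA UA))) :=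
  ⟨_, derives_sound (n := 100) (t := (transferForget TransferForward CUA).close)
    (by decide +kernel)⟩

open HTm in
theorem provable_categoricalUnivalence : Provable (ITT.arrow TransferBackward.close
    (ITT.arrow ForgetInvertible.close (ITT.arrow UA CUA))) :=
  ⟨_, derives_sound (n := 100) (t := (transferForget TransferBackward UA).close)
    (by decide +kernel)⟩

open HTm in
theorem provable_naiveFunext : Provable (ITT.arrow UA NaiveFunext.close) :=
  ⟨_, derives_sound (n := 100) (t := naiveFunext.close) (by decide +kernel)⟩

open HTm in
theorem provable_funextOfNaive : Provable (ITT.arrow NaiveFunext.close FE) :=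
  ⟨_, derives_sound (n := 100) (t := funextOfNaive.close) (by decide +kernel)⟩

open HTm in
theorem provable_combine : Provable
    (ITT.arrow (ITT.arrow UA NaiveFunext.close) (ITT.arrow (ITT.arrow NaiveFunext.close FE)
      (ITT.arrow (ITT.arrow FE ForgetInvertible.close)
        (ITT.arrow (ITT.arrow ForgetInvertible.close (ITT.arrow CUA UA))
          (ITT.arrow (ITT.arrow ForgetInvertible.close (ITT.arrow UA CUA))
            (iff UA (ITT.prod CUA FE))))))) :=
  ⟨_, derives_sound (n := 100) (t := combine.close) (by decide +kernel)⟩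

/-- Application of closed terms acts as a cut, so each ingredient is checked with its predecessors
as hypotheses rather than with their proof terms unfolded. -/
theorem Provable.mp {A B : Tm} (hf : Provable (arrow A B)) (ha : Provable A) : Provable B := by
  obtain ⟨f, hf⟩ := hf
  obtain ⟨a, ha⟩ := ha
  exact ⟨_, by simpa using hf.app ha⟩

theorem provable_univalence_iff : Provable (iff UA (prod CUA FE)) :=
  ((((provable_combine.mp provable_naiveFunext).mp provable_funextOfNaive).mp
    (provable_forgetInvertible.mp provable_totalInvertible)).mp
    (provable_univalence.mp provable_transferForward)).mp
    (provable_categoricalUnivalence.mp provable_transferBackward)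

end ITT

theorem mainTheorem4 : ITT.Provable (ITT.iff ITT.UA (ITT.prod ITT.CUA ITT.FE)) :=
  ITT.provable_univalence_iff
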